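/- Let $n,m,k$ be nonnegative integers. The following three sets are pairwise in bijection. 1. $\mathcal H^{(k)}_{n,m}$: the hesitating tableaux of length $2n$ with height at most $k$ that end in the one-row shape $(m)$ (with $(0)=\emptyset$). These are the sequences $\emptyset=\lambda^0,\lambda^1,\dots,\lambda^{2n}=(m)$ of Ferrers diagrams, each with at most $k$ rows, such that for every $0\le i<n$ the passage $\lambda^{2i}\to\lambda^{2i+1}\to\lambda^{2i+2}$ is of one of the forms: do nothing, then add a box; remove a box, then do nothing; add a box, then remove a box. 2. $\mathcal L^{(k)}_{n,m}$: the $W_k$-hesitating lattice walks of length $2n$ from $\delta=(k,k-1,\dots,1)$ to $\delta+m e_1=(m+k,k-1,\dots,1)$. These are the walks all of whose points lie in $W_k=\{(x_1,\dots,x_k)\in\mathbb Z^k: x_1>x_2>\dots>x_k>0\}$ and whose steps come in consecutive pairs of the following forms, with $1\le i,j\le k$: a stay step followed by a step $e_i$; a step $-e_i$ followed by a stay step; a step $e_i$ followed by a step $-e_j$. (For $k=0$ there is no vector $e_1$, and the set is taken to be empty if $m>0$.) 3. $\Omega^{(k)}_{n,m}$: the open partition diagrams on the vertices $1,\dots,n$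 with exactly $m$ open arcs that contain no enhanced $(k+1)$-nesting and no future enhanced $(k+1)$-nesting. An open partition diagram consists of closed arcs $(i,j)$ with $1\le i<j\le n$ and open arcs, which have only a left endpoint $i\in\{1,\dots,n\}$, such that every vertex is the left endpoint of at most one arc (closed or open) and the right endpoint of at most one closed arc. An enhanced $l$-nesting consists of $l$ pairs $(i_1,j_1),\dots,(i_l,j_l)$ with $i_1<\dots<i_l\le j_l<\dots<j_1$, each of which is a closed arc or a loop $(v,v)$ at a vertex $v$ that is an endpoint of no arc, closed or open. A future enhanced $(l+1)$-nesting consists of an open arc and an enhanced $l$-nesting such that the left endpoint of the open arc is strictly smaller than all left endpoints of the nesting (for $l=0$: just an open arc). -/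

import Mathlib

namespace Hesitating

/-- A sequence `s 0, s 1, …, s (2n)` is hesitating with respect to a relation `up` (read `up x y`
as "`y` arises from `x` by an elementary increase", so that `up y x` says that `y` arises from `x`
by an elementary decrease) if each of its `n` consecutive pairs of moves is of one of the forms
(i) do nothing, then increase; (ii) decrease, then do nothing; (iii) increase, then decrease. -/
def IsHesitating {α : Type} (up : α → α → Prop) {n : ℕ} (s : Fin (2 * n + 1) → α) : Prop :=
  ∀ i : Fin n,
    let x := s ⟨2 * i, by omega⟩
    let y := s ⟨2 * i + 1, by omega⟩
    let z := s ⟨2 * i + 2, by omega⟩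
    (y = x ∧ up y z) ∨ (up y x ∧ z = y) ∨ (up x y ∧ up z y)

/-! ### Tableaux -/

/-- The Ferrers diagram `μ` arises from `l` by adding one box. -/
def AddBox (l μ : YoungDiagram) : Prop :=
  ∃ c : ℕ × ℕ, c ∉ l.cells ∧ μ.cells = insert c l.cells

/-- Hesitating tableaux of length `2n`, starting at the empty shape, all of whose shapes have at
most `k` rows (`colLen 0` is the length of the first column), ending in the one-row shape `(m)`. -/
def tableaux (k n m : ℕ) : Set (Fin (2 * n + 1) → YoungDiagram) :=
  {s | IsHesitating AddBox s ∧ s 0 = ⊥ ∧ (∀ i, (s i).colLen 0 ≤ k) ∧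
    (s (Fin.last (2 * n))).cells = {0} ×ˢ Finset.range m}

/-! ### Lattice walks -/

/-- The region `x₁ > x₂ > ⋯ > x_k > 0` of `ℤ^k`. -/
def chamber (k : ℕ) : Set (Fin k → ℤ) :=
  {x | StrictAnti x ∧ ∀ i, 0 < x i}

/-- The point `δ = (k, k - 1, …, 1)`. -/
def delta (k : ℕ) : Fin k → ℤ := fun i => (k : ℤ) - (i : ℕ)

/-- The lattice point `y` arises from `x` by a step `e_i`. -/
def UnitStep {k : ℕ} (x y : Fin k → ℤ) : Prop :=
  ∃ i : Fin k, y = x + Pi.single i 1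

/-- `x = δ + m e₁ = (m + k, k - 1, …, 1)`. The vector `e₁` exists only for `k > 0`; for `k = 0`
the only such point is `δ`, with `m = 0`. -/
def IsEndpoint (k m : ℕ) (x : Fin k → ℤ) : Prop :=
  (m = 0 ∧ x = delta k) ∨ ∃ h : 0 < k, x = delta k + Pi.single ⟨0, h⟩ (m : ℤ)

/-- Hesitating lattice walks of length `2n` in the chamber, from `δ` to `δ + m e₁`, given by the
sequence of their points. -/
def walks (k n m : ℕ) : Set (Fin (2 * n + 1) → Fin k → ℤ) :=
  {w | IsHesitating UnitStep w ∧ (∀ i, w i ∈ chamber k) ∧ w 0 = delta k ∧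
    IsEndpoint k m (w (Fin.last (2 * n)))}

/-! ### Open partition diagrams -/

/-- An open partition diagram on the vertices `0 < 1 < ⋯ < n - 1`: closed arcs `(i, j)` with
`i < j`, and open arcs, which have a left endpoint only. Each vertex is the left endpoint of at
most one arc, closed or open, and the right endpoint of at most one closed arc. (The closed arcs
alone thus form the arc diagram of a set partition, whose blocks are the maximal chains
`a₁ < a₂ < ⋯ < a_j` of arcs `(a₁, a₂), …, (a_{j-1}, a_j)`, and an open arc can only start at the
largest element of a block.) -/
@[ext]
structure OpenPartitionDiagram (n : ℕ) where
  arcs : Finset (Fin n × Fin n)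
  openArcs : Finset (Fin n)
  lt_of_mem : ∀ i j, (i, j) ∈ arcs → i < j
  left_unique : ∀ i j j', (i, j) ∈ arcs → (i, j') ∈ arcs → j = j'
  right_unique : ∀ i i' j, (i, j) ∈ arcs → (i', j) ∈ arcs → i = i'
  not_mem_openArcs : ∀ i j, (i, j) ∈ arcs → i ∉ openArcs

namespace OpenPartitionDiagram

variable {n : ℕ} (D : OpenPartitionDiagram n)

/-- A vertex that is an endpoint of no arc, closed or open. -/
def IsIsolated (v : Fin n) : Prop :=
  v ∉ D.openArcs ∧ ∀ u, (v, u) ∉ D.arcs ∧ (u, v) ∉ D.arcs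

/-- The arcs that take part in enhanced nestings: the closed arcs, and a loop `(v, v)` at each
isolated vertex `v`. -/
def EnhancedArc (i j : Fin n) : Prop :=
  (i, j) ∈ D.arcs ∨ (i = j ∧ D.IsIsolated i)

/-- The arcs `(a t, b t)` form an enhanced `l`-nesting
`a₁ < a₂ < ⋯ < a_l ≤ b_l < ⋯ < b₂ < b₁`. -/
def IsEnhancedNesting {l : ℕ} (a b : Fin l → Fin n) : Prop :=
  StrictMono a ∧ StrictAnti b ∧ ∀ t, a t ≤ b t ∧ D.EnhancedArc (a t) (b t)

/-- `D` contains an enhanced `l`-nesting. -/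
def HasEnhancedNesting (l : ℕ) : Prop :=
  ∃ a b : Fin l → Fin n, D.IsEnhancedNesting a b

/-- `D` contains a future enhanced `(l + 1)`-nesting: an open arc whose left endpoint is to the
left of an enhanced `l`-nesting. -/
def HasFutureEnhancedNestingSucc (l : ℕ) : Prop :=
  ∃ o ∈ D.openArcs, ∃ a b : Fin l → Fin n, D.IsEnhancedNesting a b ∧ ∀ t, o < a t

end OpenPartitionDiagram

/-- Open partition diagrams on `n` vertices with `m` open arcs, with neither an enhanced
`(k + 1)`-nesting nor a future enhanced `(k + 1)`-nesting. -/
def openDiagrams (k n m : ℕ) : Set (OpenPartitionDiagram n) :=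
  {D | D.openArcs.card = m ∧ ¬ D.HasEnhancedNesting (k + 1) ∧
    ¬ D.HasFutureEnhancedNestingSucc k}

end Hesitating

namespace Hesitating

/-! ### Labelled paths -/

/-- The moves of a labelled path: increase the label, decrease it, or check that its statistic
is bounded by `c`. -/
inductive Move
  | up
  | down
  | check (c : ℤ)

variable {α : Type} (up : α → α → Prop) (s : α → ℤ)

/-- The sequences of labels that follow a given list of moves from `x` to `y`. -/
def LabelledPath : List Move → α → α → Type
  | [], x, y => PLift (x = y)
  | .up :: w, x, y => Σ z : {z // up x z}, LabelledPath w z y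
  | .down :: w, x, y => Σ z : {z // up z x}, LabelledPath w z y
  | .check c :: w, x, y => PLift (s x ≤ c) × LabelledPath w x y

/-- The growth rule: cells of a growth diagram can be filled in locally, in a way that controls
the statistic `s`; and the labels `e 0, e 1, …` form a chain in which each has only its predecessor
below it. -/
structure GrowthRule (e : ℕ → α) : Prop where
  flip : ∀ x y (cs : List ℤ), Nonempty ({z // up x z ∧ up y z ∧ ∀ c ∈ cs, s z ≤ c} ≃
    {r // up r x ∧ up r y ∧ ∀ c ∈ cs, s x ≤ c ∧ s y ≤ c} ⊕
      {_u : Unit // x = y ∧ ∀ c ∈ cs, s x ≤ c - 1})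
  up_iff : ∀ x m, up x (e m) ↔ ∃ p, m = p + 1 ∧ x = e p
  stat_zero : s (e 0) = 0
  stat_succ : ∀ m, s (e (m + 1)) = 1

namespace LabelledPath

variable {up s}

def checksEquiv (cs : List ℤ) (w : List Move) (x y : α) :
    LabelledPath up s (cs.map .check ++ w) x y ≃
      PLift (∀ c ∈ cs, s x ≤ c) × LabelledPath up s w x y :=
  match cs with
  | [] => ⟨fun p => ⟨⟨by simp⟩, p⟩, fun p => p.2, fun _ => rfl, fun _ => rfl⟩
  | c :: cs =>
    { toFun := fun p =>
        ⟨⟨List.forall_mem_cons.2 ⟨p.1.down, (checksEquiv cs w x y p.2).1.down⟩⟩,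
          (checksEquiv cs w x y p.2).2⟩
      invFun := fun p =>
        ⟨⟨(List.forall_mem_cons.1 p.1.down).1⟩,
          (checksEquiv cs w x y).symm ⟨⟨(List.forall_mem_cons.1 p.1.down).2⟩, p.2⟩⟩
      left_inv := fun p => Prod.ext rfl ((checksEquiv cs w x y).symm_apply_apply p.2)
      right_inv := fun p => Prod.ext rfl (by simp) }

def upDownEquiv (cs : List ℤ) (v : List Move) (x y : α) :
    LabelledPath up s (.up :: (cs.map .check ++ .down :: v)) x y ≃
      Σ z', {z // up x z ∧ up z' z ∧ ∀ c ∈ cs, s z ≤ c} × LabelledPath up s v z' y :=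
  (Equiv.sigmaCongrRight fun z : {z // up x z} => checksEquiv cs (.down :: v) z.1 y).trans
    { toFun := fun p => ⟨p.2.2.1.1, ⟨p.1.1, p.1.2, p.2.2.1.2, p.2.1.down⟩, p.2.2.2⟩
      invFun := fun p => ⟨⟨p.2.1.1, p.2.1.2.1⟩, ⟨p.2.1.2.2.2⟩, ⟨⟨p.1, p.2.1.2.2.1⟩, p.2.2⟩⟩
      left_inv := fun _ => rfl
      right_inv := fun _ => rfl }

def downUpEquiv (cs : List ℤ) (v : List Move) (x y : α) :
    LabelledPath up s (cs.map .check ++ .down :: .up :: (cs.map .check ++ v)) x y ≃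
      Σ z', {r // up r x ∧ up r z' ∧ ∀ c ∈ cs, s x ≤ c ∧ s z' ≤ c} × LabelledPath up s v z' y :=
  ((checksEquiv (up := up) (s := s) cs (.down :: .up :: (cs.map .check ++ v)) x y).trans <|
    Equiv.prodCongrRight fun _ =>
    Equiv.sigmaCongrRight fun r : {r // up r x} =>
      Equiv.sigmaCongrRight fun z : {z // up r.1 z} =>
      checksEquiv (up := up) (s := s) cs v z.1 y).trans
    { toFun := fun p => ⟨p.2.2.1.1, ⟨p.2.1.1, p.2.1.2, p.2.2.1.2,
        fun c hc => ⟨p.1.down c hc, p.2.2.2.1.down c hc⟩⟩, p.2.2.2.2⟩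
      invFun := fun p => ⟨⟨fun c hc => (p.2.1.2.2.2 c hc).1⟩, ⟨p.2.1.1, p.2.1.2.1⟩,
        ⟨p.1, p.2.1.2.2.1⟩, ⟨fun c hc => (p.2.1.2.2.2 c hc).2⟩, p.2.2⟩
      left_inv := fun _ => rfl
      right_inv := fun _ => rfl }

def cancelEquiv (cs : List ℤ) (v : List Move) (x y : α) :
    LabelledPath up s ((cs.map (· - 1)).map .check ++ v) x y ≃
      Σ z', {_u : Unit // x = z' ∧ ∀ c ∈ cs, s x ≤ c - 1} × LabelledPath up s v z' y :=
  (checksEquiv (cs.map (· - 1)) v x y).trans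
    { toFun := fun p => ⟨x, ⟨(), rfl, fun c hc => p.1.down _ (List.mem_map_of_mem hc)⟩, p.2⟩
      invFun := fun p => ⟨⟨by
          intro c hc
          obtain ⟨b, hb, rfl⟩ := List.mem_map.1 hc
          exact p.2.1.2.2 b hb⟩, p.2.1.2.1 ▸ p.2.2⟩
      left_inv := fun _ => rfl
      right_inv := by
        rintro ⟨z, ⟨_, rfl, _⟩, p⟩
        rfl }

variable {e : ℕ → α}

theorem flip_equiv (h : GrowthRule up s e) (cs : List ℤ) (v : List Move) (x y : α) :
    Nonempty (LabelledPath up s (.up :: (cs.map .check ++ .down :: v)) x y ≃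
      LabelledPath up s (cs.map .check ++ .down :: .up :: (cs.map .check ++ v)) x y ⊕
        LabelledPath up s ((cs.map (· - 1)).map .check ++ v) x y) :=
  ⟨(upDownEquiv cs v x y).trans <|
    (Equiv.sigmaCongrRight fun z =>
      (Equiv.prodCongrLeft fun _ => (h.flip x z cs).some).trans
        (Equiv.sumProdDistrib _ _ _)).trans <|
    (Equiv.sigmaSumDistrib _ _).trans <|
    Equiv.sumCongr (downUpEquiv cs v x y).symm (cancelEquiv cs v x y).symm⟩

theorem append_equiv {a b c : List Move} {y : α}
    (h : ∀ x, Nonempty (LabelledPath up s a x y ≃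
      LabelledPath up s b x y ⊕ LabelledPath up s c x y)) (u : List Move) (x : α) :
    Nonempty (LabelledPath up s (u ++ a) x y ≃
      LabelledPath up s (u ++ b) x y ⊕ LabelledPath up s (u ++ c) x y) := by
  induction u generalizing x with
  | nil => exact h x
  | cons t u ih =>
    cases t with
    | up =>
      exact ⟨(Equiv.sigmaCongrRight fun z : {z // up x z} => (ih z.1).some).trans
        (Equiv.sigmaSumDistrib _ _)⟩
    | down =>
      exact ⟨(Equiv.sigmaCongrRight fun z : {z // up z x} => (ih z.1).some).trans
        (Equiv.sigmaSumDistrib _ _)⟩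
    | check c =>
      exact ⟨(Equiv.prodCongrRight fun _ => (ih x).some).trans (Equiv.prodSumDistrib _ _ _)⟩

/-- A path that decreases before it increases cannot start at the bottom. -/
theorem isEmpty_of_down (h : GrowthRule up s e) (cs : List ℤ) (v : List Move) (y : α) :
    IsEmpty (LabelledPath up s (cs.map .check ++ .down :: v) (e 0) y) := by
  refine ⟨fun p => ?_⟩
  obtain ⟨⟨z, hz⟩, -⟩ := (checksEquiv cs _ _ _ p).2
  obtain ⟨p, hp, -⟩ := (h.up_iff _ _).1 hz
  omega

end LabelledPath

end Hesitating

namespace Hesitating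

/-! ### Words and their fillings -/

/-- The letters of a word: left endpoints and right endpoints of arcs, named by elements of `I`,
and checks that bound the length of the nestings at their position. -/
inductive Token (I : Type)
  | left (i : I)
  | right (j : I)
  | check (c : ℤ)

/-- `c` bounds the cardinality of the nestings among the pairs of `F` in `A × B`. -/
def NestingBound {I J : Type} [LinearOrder I] [LinearOrder J]
    (F : Set (I × J)) (A : Set I) (B : Set J) (c : ℤ) : Prop :=
  ∀ S : Finset (I × J), (∀ p ∈ S, p ∈ F ∧ p.1 ∈ A ∧ p.2 ∈ B) →
    (∀ p ∈ S, ∀ q ∈ S, p ≠ q → (p.1 < q.1 ∧ q.2 < p.2) ∨ (q.1 < p.1 ∧ p.2 < q.2)) →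
    (S.card : ℤ) ≤ c

section NestingBound

variable {I J : Type} [LinearOrder I] [LinearOrder J] {F F' : Set (I × J)} {A A' : Set I}
  {B B' : Set J} {c : ℤ} {i : I} {j : J}

theorem NestingBound.mono (h : NestingBound F A B c)
    (hF : ∀ p, p ∈ F' ∧ p.1 ∈ A' ∧ p.2 ∈ B' → p ∈ F ∧ p.1 ∈ A ∧ p.2 ∈ B) :
    NestingBound F' A' B' c :=
  fun S hS hc => h S (fun p hp => hF p (hS p hp)) hc

theorem nestingBound_congr
    (hF : ∀ p, p ∈ F ∧ p.1 ∈ A ∧ p.2 ∈ B ↔ p ∈ F' ∧ p.1 ∈ A' ∧ p.2 ∈ B') :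
    NestingBound F A B c ↔ NestingBound F' A' B' c :=
  ⟨fun h => h.mono fun p => (hF p).2, fun h => h.mono fun p => (hF p).1⟩

/-- At a corner without an arc, a nesting misses the last row or the last column. -/
theorem nestingBound_insert_insert (hi : ∀ a ∈ A, a < i) (hj : ∀ b ∈ B, j < b)
    (hij : (i, j) ∉ F) :
    NestingBound F (insert i A) (insert j B) c ↔
      NestingBound F A (insert j B) c ∧ NestingBound F (insert i A) B c := by
  refine ⟨fun h => ⟨h.mono fun p hp => ⟨hp.1, Or.inr hp.2.1, hp.2.2⟩,
    h.mono fun p hp => ⟨hp.1, hp.2.1, Or.inr hp.2.2⟩⟩, fun ⟨h₁, h₂⟩ S hS hc => ?_⟩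
  by_cases h : ∃ p ∈ S, p.1 = i
  · obtain ⟨p, hp, rfl⟩ := h
    refine h₂ S (fun q hq => ⟨(hS q hq).1, (hS q hq).2.1, (hS q hq).2.2.resolve_left ?_⟩) hc
    rintro rfl
    by_cases hpq : p = q
    · subst hpq
      exact hij (hS p hp).1
    · rcases hc p hp q hq hpq with ⟨h, -⟩ | ⟨-, h⟩
      · rcases (hS q hq).2.1 with h' | h'
        · exact h.ne' h'
        · exact lt_asymm h (hi _ h')
      · rcases (hS p hp).2.2 with h' | h'
        · exact h.ne h'
        · exact lt_asymm h (hj _ h')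
  · push Not at h
    exact h₁ S (fun q hq => ⟨(hS q hq).1, (hS q hq).2.1.resolve_left (h q hq), (hS q hq).2.2⟩) hc

/-- At a corner with an arc, that arc extends every nesting. -/
theorem nestingBound_insert (hi : ∀ a ∈ A, a < i) (hj : ∀ b ∈ B, j < b)
    (hFi : ∀ b, (i, b) ∉ F) (hFj : ∀ a, (a, j) ∉ F) :
    NestingBound (insert (i, j) F) (insert i A) (insert j B) c ↔ NestingBound F A B (c - 1) := by
  classical
  constructor
  · intro h S hS hc
    have hn : (i, j) ∉ S := fun h => hFi _ (hS _ h).1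
    have := h (insert (i, j) S) ?_ ?_
    · rw [Finset.card_insert_of_notMem hn] at this
      push_cast at this
      omega
    · intro p hp
      rcases Finset.mem_insert.1 hp with rfl | hp
      · simp
      · exact ⟨Or.inr (hS p hp).1, Or.inr (hS p hp).2.1, Or.inr (hS p hp).2.2⟩
    · intro p hp q hq hpq
      rcases Finset.mem_insert.1 hp with rfl | hp <;> rcases Finset.mem_insert.1 hq with rfl | hq
      · exact absurd rfl hpq
      · exact Or.inr ⟨hi _ (hS q hq).2.1, hj _ (hS q hq).2.2⟩
      · exact Or.inl ⟨hi _ (hS p hp).2.1, hj _ (hS p hp).2.2⟩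
      · exact hc p hp q hq hpq
  · intro h S hS hc
    have := h (S.erase (i, j)) ?_ ?_
    · have h' := Finset.pred_card_le_card_erase (s := S) (a := (i, j))
      omega
    · intro p hp
      obtain ⟨hp, hpS⟩ := Finset.mem_erase.1 hp
      have hF := (hS p hpS).1.resolve_left hp
      refine ⟨hF, (hS p hpS).2.1.resolve_left ?_, (hS p hpS).2.2.resolve_left ?_⟩
      · rintro rfl
        exact hFi _ hF
      · rintro rfl
        exact hFj _ hF
    · exact fun p hp q hq => hc p (Finset.mem_of_mem_erase hp) q (Finset.mem_of_mem_erase hq)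

end NestingBound

variable {I : Type}

/-- The names of the left endpoints in a word. -/
def lefts (w : List (Token I)) : Set I := {i | .left i ∈ w}

/-- The names of the right endpoints in a word. -/
def rights (w : List (Token I)) : Set (WithTop I) := {b | ∃ j : I, b = j ∧ .right j ∈ w}

section simp_lemmas

variable (u w : List (Token I)) (i : I) (c : ℤ) (cs : List ℤ)

@[simp] theorem lefts_nil : lefts ([] : List (Token I)) = ∅ := by simp [lefts]

@[simp] theorem lefts_left : lefts (.left i :: w) = insert i (lefts w) := by
  ext; simp [lefts]

@[simp] theorem lefts_right : lefts (.right i :: w) = lefts w := by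
  ext; simp [lefts]

@[simp] theorem lefts_check : lefts (.check c :: w) = lefts w := by
  ext; simp [lefts]

@[simp] theorem lefts_append : lefts (u ++ w) = lefts u ∪ lefts w := by
  ext; simp [lefts]

@[simp] theorem lefts_checks : lefts (cs.map .check : List (Token I)) = ∅ := by
  ext; simp [lefts]

@[simp] theorem rights_nil : rights ([] : List (Token I)) = ∅ := by simp [rights]

@[simp] theorem rights_left : rights (.left i :: w) = rights w := by
  ext; simp [rights]

@[simp] theorem rights_right : rights (.right i :: w) = insert (i : WithTop I) (rights w) := by
  ext b
  simp only [rights, List.mem_cons, Token.right.injEq, Set.mem_ofPred_eq, Set.mem_insert_iff]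
  constructor
  · rintro ⟨j, rfl, rfl | h⟩
    · exact Or.inl rfl
    · exact Or.inr ⟨j, rfl, h⟩
  · rintro (rfl | ⟨j, rfl, h⟩)
    · exact ⟨i, rfl, Or.inl rfl⟩
    · exact ⟨j, rfl, Or.inr h⟩

@[simp] theorem rights_check : rights (.check c :: w) = rights w := by
  ext; simp [rights]

@[simp] theorem rights_append : rights (u ++ w) = rights u ∪ rights w := by
  ext; simp [rights, and_or_left, exists_or]

@[simp] theorem rights_checks : rights (cs.map .check : List (Token I)) = ∅ := by
  ext; simp [rights]

end simp_lemmas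

/-- No pair in `F` has its right endpoint before its left endpoint in the word. -/
def LeftFirst (F : Set (I × WithTop I)) : List (Token I) → Prop
  | [] => True
  | .right j :: w => (∀ a ∈ lefts w, (a, (j : WithTop I)) ∉ F) ∧ LeftFirst F w
  | .left _ :: w => LeftFirst F w
  | .check _ :: w => LeftFirst F w

theorem leftFirst_append (F : Set (I × WithTop I)) (u w : List (Token I)) :
    LeftFirst F (u ++ w) ↔ LeftFirst F u ∧ LeftFirst F w ∧
      ∀ b ∈ rights u, ∀ a ∈ lefts w, (a, b) ∉ F := by
  induction u with
  | nil => simp [LeftFirst]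
  | cons t u ih =>
    cases t with
    | left i => simp [LeftFirst, ih]
    | right j =>
      simp only [List.cons_append, LeftFirst, ih, lefts_append, rights_right, Set.mem_union,
        Set.forall_mem_insert, or_imp, forall_and]
      tauto
    | check c => simp [LeftFirst, ih]

@[simp] theorem leftFirst_checks (F : Set (I × WithTop I)) (cs : List ℤ) :
    LeftFirst F (cs.map .check : List (Token I)) := by
  induction cs with
  | nil => trivial
  | cons c cs ih => exact ih

theorem leftFirst_congr {F F' : Set (I × WithTop I)} {w : List (Token I)}
    (h : ∀ a ∈ lefts w, ∀ b ∈ rights w, (a, b) ∈ F ↔ (a, b) ∈ F') :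
    LeftFirst F w ↔ LeftFirst F' w := by
  induction w with
  | nil => rfl
  | cons t w ih =>
    cases t with
    | left i => exact ih fun a ha b hb => h a (by simp [ha]) b (by simpa)
    | right j =>
      refine and_congr (forall₂_congr fun a ha => not_congr (h a (by simpa) _ (by simp)))
        (ih fun a ha b hb => h a (by simpa) b (by simp [hb]))
    | check c => exact ih fun a ha b hb => h a (by simpa) b (by simpa)

/-- The word has a left endpoint `i`, only checks, and a right endpoint `j` in a row. -/
abbrev cornerWord (u : List (Token I)) (i : I) (cs : List ℤ) (j : I) (v : List (Token I)) :
    List (Token I) :=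
  u ++ .left i :: (cs.map .check ++ .right j :: v)

/-- The word `cornerWord u i cs j v` with the endpoints `i` and `j` interchanged. -/
abbrev flippedWord (u : List (Token I)) (i : I) (cs : List ℤ) (j : I) (v : List (Token I)) :
    List (Token I) :=
  u ++ (cs.map .check ++ .right j :: .left i :: (cs.map .check ++ v))

/-- The word `cornerWord u i cs j v` without the endpoints `i` and `j`. -/
abbrev cancelledWord (u : List (Token I)) (cs : List ℤ) (v : List (Token I)) : List (Token I) :=
  u ++ ((cs.map (· - 1)).map .check ++ v)

section corner

variable {u v : List (Token I)} {i j : I} {cs : List ℤ}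

theorem lefts_corner : lefts (cornerWord u i cs j v) = insert i (lefts u ∪ lefts v) := by
  simp

theorem rights_corner :
    rights (cornerWord u i cs j v) = insert (j : WithTop I) (rights u ∪ rights v) := by
  simp

theorem lefts_flipped : lefts (flippedWord u i cs j v) = insert i (lefts u ∪ lefts v) := by
  simp

theorem rights_flipped :
    rights (flippedWord u i cs j v) = insert (j : WithTop I) (rights u ∪ rights v) := by
  simp

theorem lefts_cancelled : lefts (cancelledWord u cs v) = lefts u ∪ lefts v := by
  simp [-List.map_map]

theorem rights_cancelled : rights (cancelledWord u cs v) = rights u ∪ rights v := by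
  simp [-List.map_map]

variable {F : Set (I × WithTop I)}

theorem leftFirst_corner :
    LeftFirst F (cornerWord u i cs j v) ↔ LeftFirst F u ∧ LeftFirst F v ∧
      (∀ b ∈ rights u, (i, b) ∉ F) ∧ (∀ a ∈ lefts v, (a, (j : WithTop I)) ∉ F) ∧
      ∀ b ∈ rights u, ∀ a ∈ lefts v, (a, b) ∉ F := by
  simp only [leftFirst_append, LeftFirst, lefts_append, lefts_checks, lefts_right,
    Set.empty_union, leftFirst_checks, rights_checks, lefts_left,
    Set.forall_mem_insert, Set.mem_empty_iff_false, false_imp_iff,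
    implies_true, true_and, and_true, forall_and]
  tauto

theorem leftFirst_flipped :
    LeftFirst F (flippedWord u i cs j v) ↔
      LeftFirst F (cornerWord u i cs j v) ∧ (i, (j : WithTop I)) ∉ F := by
  rw [leftFirst_corner]
  simp only [leftFirst_append, LeftFirst, lefts_append, lefts_checks, lefts_right,
    Set.empty_union, leftFirst_checks, rights_checks, lefts_left,
    Set.forall_mem_insert, Set.mem_empty_iff_false, false_imp_iff,
    implies_true, true_and, and_true, forall_and]
  tauto

theorem leftFirst_cancelled :
    LeftFirst F (cancelledWord u cs v) ↔ LeftFirst F u ∧ LeftFirst F v ∧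
      ∀ b ∈ rights u, ∀ a ∈ lefts v, (a, b) ∉ F := by
  simp only [leftFirst_append, lefts_append, lefts_checks,
    Set.empty_union, leftFirst_checks, rights_checks,
    Set.mem_empty_iff_false, false_imp_iff,
    implies_true, true_and, and_true]

end corner

variable [LinearOrder I]

/-- All checks of a word hold, where `A` contains the left endpoints before the word and `B` the
right endpoints after it. -/
def Checks (F : Set (I × WithTop I)) : Set I → Set (WithTop I) → List (Token I) → Prop
  | _, _, [] => True
  | A, B, .left i :: w => Checks F (insert i A) B w
  | A, B, .right _ :: w => Checks F A B w
  | A, B, .check c :: w => NestingBound F A (B ∪ rights w) c ∧ Checks F A B w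

theorem checks_append {F : Set (I × WithTop I)} {A : Set I} {B : Set (WithTop I)}
    (u w : List (Token I)) :
    Checks F A B (u ++ w) ↔ Checks F A (B ∪ rights w) u ∧ Checks F (A ∪ lefts u) B w := by
  induction u generalizing A with
  | nil => simp [Checks]
  | cons t u ih =>
    cases t with
    | left i =>
      have : A ∪ insert i (lefts u) = insert i A ∪ lefts u := by
        rw [Set.union_insert, Set.insert_union]
      simp [Checks, ih, this]
    | right j => simp [Checks, ih]
    | check c =>
      have : B ∪ (rights u ∪ rights w) = B ∪ rights w ∪ rights u := by
        rw [Set.union_assoc, Set.union_comm (rights u)]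
      simp [Checks, ih, this, and_assoc]

theorem checks_checks {F : Set (I × WithTop I)} {A : Set I} {B : Set (WithTop I)} (cs : List ℤ) :
    Checks F A B (cs.map .check) ↔ ∀ c ∈ cs, NestingBound F A B c := by
  induction cs with
  | nil => simp [Checks]
  | cons c cs ih => simp [Checks, ih]

theorem checks_congr {F F' : Set (I × WithTop I)} {A A' : Set I} {B B' : Set (WithTop I)}
    {w : List (Token I)}
    (h : ∀ C ⊆ lefts w, ∀ D ⊆ rights w, ∀ p, p ∈ F ∧ p.1 ∈ A ∪ C ∧ p.2 ∈ B ∪ D ↔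
      p ∈ F' ∧ p.1 ∈ A' ∪ C ∧ p.2 ∈ B' ∪ D) :
    Checks F A B w ↔ Checks F' A' B' w := by
  induction w generalizing A A' with
  | nil => simp [Checks]
  | cons t w ih =>
    cases t with
    | left i =>
      refine ih fun C hC D hD p => ?_
      have := h (insert i C) (by simpa using Set.insert_subset_insert hC) D (by simpa) p
      rwa [Set.union_insert, Set.union_insert, ← Set.insert_union, ← Set.insert_union] at this
    | right j =>
      exact ih fun C hC D hD p =>
        h C (by simpa) D (by simpa using hD.trans (Set.subset_insert _ _)) p
    | check c =>
      refine and_congr (nestingBound_congr fun p => ?_) (ih fun C hC D hD p => ?_)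
      · simpa using h ∅ (Set.empty_subset _) (rights w) (by simp) p
      · exact h C (by simpa) D (by simpa) p

/-- The left endpoints and the right endpoints of a word appear in increasing order. -/
def SortedWord : List (Token I) → Prop
  | [] => True
  | .left i :: w => (∀ a ∈ lefts w, i < a) ∧ SortedWord w
  | .right j :: w => (∀ b ∈ rights w, (j : WithTop I) < b) ∧ SortedWord w
  | .check _ :: w => SortedWord w

theorem sortedWord_append (u w : List (Token I)) :
    SortedWord (u ++ w) ↔ SortedWord u ∧ SortedWord w ∧
      (∀ a ∈ lefts u, ∀ b ∈ lefts w, a < b) ∧ ∀ a ∈ rights u, ∀ b ∈ rights w, a < b := by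
  induction u with
  | nil => simp [SortedWord]
  | cons t u ih =>
    cases t <;> simp only [List.cons_append, SortedWord, ih, lefts_append, rights_append,
      lefts_left, lefts_right, lefts_check, rights_left, rights_right, rights_check, Set.mem_union,
      Set.forall_mem_insert, or_imp, forall_and] <;> tauto

@[simp] theorem sortedWord_checks (cs : List ℤ) :
    SortedWord (cs.map .check : List (Token I)) := by
  induction cs with
  | nil => trivial
  | cons c cs ih => exact ih

/-- `F` matches each right endpoint of the word `w` to an earlier left endpoint, and `m` left
endpoints to `⊤`, so that all checks hold. -/
structure Filling (w : List (Token I)) (m : ℕ) (F : Set (I × WithTop I)) : Prop where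
  mem_left : ∀ i b, (i, b) ∈ F → i ∈ lefts w
  mem_right : ∀ i b, (i, b) ∈ F → b = ⊤ ∨ b ∈ rights w
  exists_left : ∀ i ∈ lefts w, ∃ b, (i, b) ∈ F
  exists_right : ∀ b ∈ rights w, ∃ i, (i, b) ∈ F
  left_unique : ∀ i b b', (i, b) ∈ F → (i, b') ∈ F → b = b'
  right_unique : ∀ i i' b, b ≠ ⊤ → (i, b) ∈ F → (i', b) ∈ F → i = i'
  leftFirst : LeftFirst F w
  ncard : {i | (i, (⊤ : WithTop I)) ∈ F}.ncard = m
  checks : Checks F ∅ {⊤} w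

section corner

variable {u v : List (Token I)} {i j : I} {cs : List ℤ} {m : ℕ} {F : Set (I × WithTop I)}

theorem sortedWord_corner :
    SortedWord (cornerWord u i cs j v) ↔
      SortedWord u ∧ SortedWord v ∧ (∀ a ∈ lefts u, a < i) ∧ (∀ a ∈ lefts v, i < a) ∧
      (∀ b ∈ rights u, b < j) ∧ (∀ b ∈ rights v, j < b) ∧
      (∀ a ∈ lefts u, ∀ b ∈ lefts v, a < b) ∧ ∀ a ∈ rights u, ∀ b ∈ rights v, a < b := by
  simp only [sortedWord_append, SortedWord, lefts_append, lefts_checks, lefts_right,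
    Set.empty_union, sortedWord_checks, rights_checks, rights_right, lefts_left,
    Set.forall_mem_insert, rights_left, rights_append, Set.mem_empty_iff_false, false_imp_iff,
    implies_true, true_and, and_true, forall_and]
  tauto

theorem SortedWord.flipped (h : SortedWord (cornerWord u i cs j v)) :
    SortedWord (flippedWord u i cs j v) := by
  rw [sortedWord_corner] at h
  simp only [sortedWord_append, SortedWord, lefts_append, lefts_checks, lefts_right,
    Set.empty_union, sortedWord_checks, rights_checks, rights_right, lefts_left,
    Set.forall_mem_insert, rights_left, rights_append, Set.mem_empty_iff_false, false_imp_iff,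
    implies_true, true_and, and_true, forall_and]
  tauto

theorem SortedWord.cancelled (h : SortedWord (cornerWord u i cs j v)) :
    SortedWord (cancelledWord u cs v) := by
  rw [sortedWord_corner] at h
  simp only [sortedWord_append, lefts_append, lefts_checks,
    Set.empty_union, sortedWord_checks, rights_checks,
    rights_append, Set.mem_empty_iff_false, false_imp_iff,
    implies_true, true_and, and_true]
  tauto

theorem checks_corner :
    Checks F ∅ {⊤} (cornerWord u i cs j v) ↔
      Checks F ∅ ({⊤} ∪ insert (j : WithTop I) (rights v)) u ∧
      (∀ c ∈ cs, NestingBound F (insert i (lefts u)) (insert (j : WithTop I) ({⊤} ∪ rights v)) c) ∧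
      Checks F (insert i (lefts u)) {⊤} v := by
  simp only [checks_append, Checks, checks_checks, lefts_checks, rights_append, rights_checks,
    rights_left, rights_right, Set.empty_union, Set.union_empty, Set.union_insert]

theorem checks_flipped :
    Checks F ∅ {⊤} (flippedWord u i cs j v) ↔
      Checks F ∅ ({⊤} ∪ insert (j : WithTop I) (rights v)) u ∧
      (∀ c ∈ cs, NestingBound F (lefts u) (insert (j : WithTop I) ({⊤} ∪ rights v)) c) ∧
      (∀ c ∈ cs, NestingBound F (insert i (lefts u)) ({⊤} ∪ rights v) c) ∧
      Checks F (insert i (lefts u)) {⊤} v := by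
  simp only [checks_append, Checks, checks_checks, lefts_checks, rights_append, rights_checks,
    rights_left, rights_right, Set.empty_union, Set.union_empty, Set.union_insert]

theorem checks_cancelled :
    Checks F ∅ {⊤} (cancelledWord u cs v) ↔
      Checks F ∅ ({⊤} ∪ rights v) u ∧
      (∀ c ∈ cs, NestingBound F (lefts u) ({⊤} ∪ rights v) (c - 1)) ∧
      Checks F (lefts u) {⊤} v := by
  simp only [checks_append, checks_checks, lefts_checks, rights_append, rights_checks,
    Set.empty_union, Set.union_empty, List.forall_mem_map]

theorem lt_of_mem_top_union_rights (h : SortedWord (cornerWord u i cs j v)) :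
    ∀ b ∈ {⊤} ∪ rights v, (j : WithTop I) < b := by
  rintro b (rfl | hb)
  · exact WithTop.coe_lt_top j
  · exact (sortedWord_corner.1 h).2.2.2.2.2.1 b hb

theorem filling_corner_iff_flipped (h : SortedWord (cornerWord u i cs j v)) :
    Filling (cornerWord u i cs j v) m F ∧ (i, (j : WithTop I)) ∉ F ↔
      Filling (flippedWord u i cs j v) m F := by
  have key : (i, (j : WithTop I)) ∉ F →
      (Checks F ∅ {⊤} (cornerWord u i cs j v) ↔ Checks F ∅ {⊤} (flippedWord u i cs j v)) := by
    intro hF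
    rw [checks_corner, checks_flipped]
    simp only [nestingBound_insert_insert (sortedWord_corner.1 h).2.2.1
      (lt_of_mem_top_union_rights h) hF, forall_and, and_assoc]
  constructor
  · rintro ⟨⟨h₁, h₂, h₃, h₄, h₅, h₆, h₇, h₈, h₉⟩, hF⟩
    rw [lefts_corner] at h₁ h₃
    rw [rights_corner] at h₂ h₄
    exact ⟨by rwa [lefts_flipped], by rwa [rights_flipped], by rwa [lefts_flipped],
      by rwa [rights_flipped], h₅, h₆, leftFirst_flipped.2 ⟨h₇, hF⟩, h₈, (key hF).1 h₉⟩
  · rintro ⟨h₁, h₂, h₃, h₄, h₅, h₆, h₇, h₈, h₉⟩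
    rw [lefts_flipped] at h₁ h₃
    rw [rights_flipped] at h₂ h₄
    obtain ⟨h₇, hF⟩ := leftFirst_flipped.1 h₇
    exact ⟨⟨by rwa [lefts_corner], by rwa [rights_corner], by rwa [lefts_corner],
      by rwa [rights_corner], h₅, h₆, h₇, h₈, (key hF).2 h₉⟩, hF⟩

theorem checks_insert_corner (h : SortedWord (cornerWord u i cs j v))
    (hFi : ∀ b, (i, b) ∉ F) (hFj : ∀ a, (a, (j : WithTop I)) ∉ F) :
    Checks (insert (i, (j : WithTop I)) F) ∅ {⊤} (cornerWord u i cs j v) ↔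
      Checks F ∅ {⊤} (cancelledWord u cs v) := by
  have hj := lt_of_mem_top_union_rights h
  rw [sortedWord_corner] at h
  obtain ⟨-, -, hiu, hiv, -, hjv, -, -⟩ := h
  have hi : i ∉ lefts u := fun h => lt_irrefl _ (hiu i h)
  rw [checks_corner, checks_cancelled]
  simp only [nestingBound_insert hiu hj hFi hFj]
  refine and_congr (checks_congr ?_) (and_congr_right fun _ => checks_congr ?_)
  · rintro C hC D hD ⟨a, b⟩
    have : i ∉ C := fun h => hi (hC h)
    simp only [Set.mem_insert_iff, Prod.mk.injEq, Set.mem_union, Set.mem_singleton_iff,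
      Set.mem_empty_iff_false]
    grind
  · rintro C hC D hD ⟨a, b⟩
    have : (j : WithTop I) ∉ D := fun h => lt_irrefl _ (hjv _ (hD h))
    have := WithTop.coe_ne_top (a := j)
    simp only [Set.mem_insert_iff, Prod.mk.injEq, Set.mem_union, Set.mem_singleton_iff]
    grind

theorem filling_corner_iff_cancelled (h : SortedWord (cornerWord u i cs j v))
    (hF : (i, (j : WithTop I)) ∉ F) :
    Filling (cornerWord u i cs j v) m (insert (i, (j : WithTop I)) F) ↔
      Filling (cancelledWord u cs v) m F := by
  obtain ⟨-, -, hiu, hiv, hju, hjv, -, -⟩ := sortedWord_corner.1 h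
  have hi : i ∉ lefts u ∪ lefts v := by
    rintro (h | h)
    exacts [lt_irrefl _ (hiu i h), lt_irrefl _ (hiv i h)]
  have hj : (j : WithTop I) ∉ rights u ∪ rights v := by
    rintro (h | h)
    exacts [lt_irrefl _ (hju _ h), lt_irrefl _ (hjv _ h)]
  have hjt := WithTop.coe_ne_top (a := j)
  have hn : {a | (a, ⊤) ∈ insert (i, (j : WithTop I)) F} = {a | (a, ⊤) ∈ F} := by
    ext a
    simp [hjt.symm]
  have key (hFi : ∀ b, (i, b) ∉ F) (hFj : ∀ a, (a, (j : WithTop I)) ∉ F) :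
      LeftFirst (insert (i, (j : WithTop I)) F) (cornerWord u i cs j v) ↔
        LeftFirst F (cancelledWord u cs v) := by
    rw [leftFirst_corner, leftFirst_cancelled]
    refine and_congr (leftFirst_congr ?_) (and_congr (leftFirst_congr ?_) ?_)
    all_goals
      simp only [Set.mem_insert_iff, Prod.mk.injEq, Set.mem_union] at *
      grind
  constructor
  · rintro ⟨h₁, h₂, h₃, h₄, h₅, h₆, h₇, h₈, h₉⟩
    have hFi : ∀ b, (i, b) ∉ F := fun b hb =>
      hF (h₅ i b j (Or.inr hb) (Or.inl rfl) ▸ hb)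
    have hFj : ∀ a, (a, (j : WithTop I)) ∉ F := fun a ha =>
      hF (h₆ a i j hjt (Or.inr ha) (Or.inl rfl) ▸ ha)
    rw [lefts_corner] at h₁ h₃
    rw [rights_corner] at h₂ h₄
    refine ⟨?_, ?_, ?_, ?_, fun i b b' hb hb' => h₅ i b b' (Or.inr hb) (Or.inr hb'),
      fun i i' b hb hi hi' => h₆ i i' b hb (Or.inr hi) (Or.inr hi'), (key hFi hFj).1 h₇, hn ▸ h₈,
      (checks_insert_corner h hFi hFj).1 h₉⟩
    all_goals
      simp only [lefts_cancelled, rights_cancelled, Set.mem_insert_iff, Prod.mk.injEq] at *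
      grind
  · rintro ⟨h₁, h₂, h₃, h₄, h₅, h₆, h₇, h₈, h₉⟩
    rw [lefts_cancelled] at h₁ h₃
    rw [rights_cancelled] at h₂ h₄
    have hFi : ∀ b, (i, b) ∉ F := fun b hb => hi (h₁ _ _ hb)
    have hFj : ∀ a, (a, (j : WithTop I)) ∉ F := fun a ha => hj ((h₂ _ _ ha).resolve_left hjt)
    refine ⟨?_, ?_, ?_, ?_, ?_, ?_, (key hFi hFj).2 h₇, hn.symm ▸ h₈,
      (checks_insert_corner h hFi hFj).2 h₉⟩
    all_goals
      simp only [lefts_corner, rights_corner, Set.mem_insert_iff, Prod.mk.injEq] at *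
      grind

theorem Filling.notMem_of_cancelled (h : SortedWord (cornerWord u i cs j v))
    (hF : Filling (cancelledWord u cs v) m F) : (i, (j : WithTop I)) ∉ F := by
  obtain ⟨-, -, hiu, hiv, -⟩ := sortedWord_corner.1 h
  intro hij
  have := hF.mem_left _ _ hij
  rw [lefts_cancelled] at this
  rcases this with h | h
  exacts [lt_irrefl _ (hiu i h), lt_irrefl _ (hiv i h)]

theorem filling_equiv (h : SortedWord (cornerWord u i cs j v)) (m : ℕ) :
    Nonempty ({F // Filling (cornerWord u i cs j v) m F} ≃
      {F // Filling (flippedWord u i cs j v) m F} ⊕ {F // Filling (cancelledWord u cs v) m F}) := by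
  classical
  refine ⟨(Equiv.sumCompl fun F : {F // Filling (cornerWord u i cs j v) m F} =>
    (i, (j : WithTop I)) ∉ F.1).symm.trans (Equiv.sumCongr ?_ ?_)⟩
  · exact (Equiv.subtypeSubtypeEquivSubtypeInter _ _).trans
      (Equiv.subtypeEquivRight fun F => filling_corner_iff_flipped h)
  · exact
      { toFun := fun F => ⟨F.1.1 \ {(i, (j : WithTop I))},
          (filling_corner_iff_cancelled h (by simp)).1 (by
            rw [Set.insert_sdiff_singleton, Set.insert_eq_of_mem (not_not.1 F.2)]
            exact F.1.2)⟩
        invFun := fun F => ⟨⟨insert (i, (j : WithTop I)) F.1,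
          (filling_corner_iff_cancelled h (F.2.notMem_of_cancelled h)).2 F.2⟩,
          not_not.2 (Set.mem_insert _ _)⟩
        left_inv := fun F => Subtype.ext <| Subtype.ext <|
          Set.insert_sdiff_singleton.trans (Set.insert_eq_of_mem (not_not.1 F.2))
        right_inv := fun F => Subtype.ext <|
          Set.insert_sdiff_self_of_notMem (F.2.notMem_of_cancelled h) }

end corner

end Hesitating

namespace Hesitating

/-! ### Labelled paths correspond to fillings -/

/-- The move of a labelled path at a letter of a word. -/
def Token.toMove {I : Type} : Token I → Move
  | .left _ => .up
  | .right _ => .down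
  | .check c => .check c

section Words

variable {I : Type}

theorem map_toMove_checks (cs : List ℤ) :
    (cs.map (Token.check : ℤ → Token I)).map Token.toMove = cs.map Move.check := by
  simp [Function.comp_def, Token.toMove]

/-- A word has a corner, or starts with a right endpoint up to checks, or has no right endpoints. -/
theorem exists_corner (w : List (Token I)) :
    (∃ u i cs j v, w = cornerWord u i cs j v) ∨
      (∃ (cs : List ℤ) (j : I) (v : List (Token I)), w = cs.map .check ++ .right j :: v) ∨
      rights w = ∅ := by
  induction w with
  | nil => simp
  | cons t w ih =>
    cases t with
    | left i =>
      rcases ih with ⟨u, i', cs, j, v, rfl⟩ | ⟨cs, j, v, rfl⟩ | h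
      · exact Or.inl ⟨.left i :: u, i', cs, j, v, rfl⟩
      · exact Or.inl ⟨[], i, cs, j, v, rfl⟩
      · simp [h]
    | right j => exact Or.inr (Or.inl ⟨[], j, w, rfl⟩)
    | check c =>
      rcases ih with ⟨u, i', cs, j, v, rfl⟩ | ⟨cs, j, v, rfl⟩ | h
      · exact Or.inl ⟨.check c :: u, i', cs, j, v, rfl⟩
      · exact Or.inr (Or.inl ⟨c :: cs, j, v, rfl⟩)
      · simp [h]

def leftCount : List (Token I) → ℕ
  | [] => 0
  | .left _ :: w => leftCount w + 1
  | .right _ :: w => leftCount w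
  | .check _ :: w => leftCount w

def rightCount : List (Token I) → ℕ
  | [] => 0
  | .left _ :: w => rightCount w
  | .right _ :: w => rightCount w + 1
  | .check _ :: w => rightCount w

/-- The number of pairs of a left endpoint and a later right endpoint. -/
def inversions : List (Token I) → ℕ
  | [] => 0
  | .left _ :: w => rightCount w + inversions w
  | .right _ :: w => inversions w
  | .check _ :: w => inversions w

theorem rightCount_append (u w : List (Token I)) :
    rightCount (u ++ w) = rightCount u + rightCount w := by
  induction u with
  | nil => simp [rightCount]
  | cons t u ih => cases t <;> grind [rightCount]

theorem inversions_append (u w : List (Token I)) :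
    inversions (u ++ w) = inversions u + leftCount u * rightCount w + inversions w := by
  induction u with
  | nil => simp [inversions, leftCount]
  | cons t u ih =>
    cases t <;> grind [inversions, leftCount, rightCount_append]

theorem count_checks (cs : List ℤ) :
    leftCount (cs.map .check : List (Token I)) = 0 ∧
      rightCount (cs.map .check : List (Token I)) = 0 ∧
      inversions (cs.map .check : List (Token I)) = 0 := by
  induction cs with
  | nil => simp [leftCount, rightCount, inversions]
  | cons c cs ih => exact ih

theorem inversions_flipped_lt (u : List (Token I)) (i : I) (cs : List ℤ) (j : I)
    (v : List (Token I)) :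
    inversions (flippedWord u i cs j v) < inversions (cornerWord u i cs j v) := by
  simp only [inversions_append, inversions, rightCount_append, rightCount,
    count_checks cs, zero_add]
  omega

theorem inversions_cancelled_lt (u : List (Token I)) (i : I) (cs : List ℤ) (j : I)
    (v : List (Token I)) :
    inversions (cancelledWord u cs v) < inversions (cornerWord u i cs j v) := by
  simp only [inversions_append, inversions, rightCount_append, rightCount,
    count_checks]
  nlinarith

/-- The checks of a word without right endpoints hold for pairwise crossing open arcs, when `p`
of them start before the word. -/
def OpenChecks : ℕ → List (Token I) → Prop
  | _, [] => True
  | p, .left _ :: w => OpenChecks (p + 1) w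
  | p, .right _ :: w => OpenChecks p w
  | p, .check c :: w => (min p 1 : ℕ) ≤ c ∧ OpenChecks p w

theorem leftFirst_of_rights_eq_empty {F : Set (I × WithTop I)} {w : List (Token I)}
    (hw : rights w = ∅) : LeftFirst F w := by
  induction w with
  | nil => trivial
  | cons t w ih =>
    cases t with
    | left i => exact ih (by simpa using hw)
    | right j => exact absurd ((rights_right _ _).symm.trans hw) (Set.insert_nonempty _ _).ne_empty
    | check c => exact ih (by simpa using hw)

end Words

section Paths

variable {I α : Type} {up : α → α → Prop} {s : α → ℤ} {e : ℕ → α}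

theorem GrowthRule.stat_eq (h : GrowthRule up s e) (p : ℕ) : s (e p) = (min p 1 : ℕ) := by
  cases p with
  | zero => simpa using h.stat_zero
  | succ p => simpa using h.stat_succ p

theorem LabelledPath.subsingleton_and_nonempty_iff (h : GrowthRule up s e) (m : ℕ)
    {w : List (Token I)} (hw : rights w = ∅) (x : α) :
    Subsingleton (LabelledPath up s (w.map Token.toMove) x (e m)) ∧
      (Nonempty (LabelledPath up s (w.map Token.toMove) x (e m)) ↔
        ∃ p, x = e p ∧ p + leftCount w = m ∧ OpenChecks p w) := by
  induction w generalizing x with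
  | nil =>
    refine ⟨inferInstanceAs (Subsingleton (PLift (x = e m))),
      fun ⟨p⟩ => ⟨m, p.down, rfl, trivial⟩, ?_⟩
    rintro ⟨p, rfl, rfl, -⟩
    exact ⟨PLift.up rfl⟩
  | cons t w ih =>
    cases t with
    | left i =>
      have ih := ih (by simpa using hw)
      have key (z : {z // up x z}) (p : LabelledPath up s (w.map Token.toMove) z (e m)) :
          ∃ q, z.1 = e (q + 1) ∧ x = e q ∧ q + 1 + leftCount w = m ∧ OpenChecks (q + 1) w := by
        obtain ⟨q, hq, hm, hc⟩ := (ih z).2.1 ⟨p⟩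
        obtain ⟨r, rfl, hr⟩ := (h.up_iff x q).1 (hq ▸ z.2)
        exact ⟨r, hq, hr, hm, hc⟩
      refine ⟨⟨?_⟩, ?_, ?_⟩
      · rintro ⟨z, p⟩ ⟨z', p'⟩
        obtain ⟨q, hq, -, hm, -⟩ := key z p
        obtain ⟨q', hq', -, hm', -⟩ := key z' p'
        obtain rfl : q = q' := by omega
        obtain rfl : z = z' := Subtype.ext (hq.trans hq'.symm)
        have := (ih z).1
        rw [Subsingleton.elim p p']
      · rintro ⟨z, p⟩
        obtain ⟨q, -, hx, hm, hc⟩ := key z p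
        exact ⟨q, hx, by simp only [leftCount]; omega, hc⟩
      · rintro ⟨p, rfl, hm, hc⟩
        obtain ⟨q⟩ := (ih (e (p + 1))).2.2 ⟨p + 1, rfl, by simp only [leftCount] at hm; omega, hc⟩
        exact ⟨⟨e (p + 1), (h.up_iff _ _).2 ⟨p, rfl, rfl⟩⟩, q⟩
    | right j => exact absurd ((rights_right _ _).symm.trans hw) (Set.insert_nonempty _ _).ne_empty
    | check c =>
      have ih := ih (by simpa using hw) x
      have := ih.1
      refine ⟨inferInstanceAs (Subsingleton (PLift (s x ≤ c) × LabelledPath up s _ x (e m))),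
        ?_, ?_⟩
      · rintro ⟨hc, p⟩
        obtain ⟨q, rfl, hm, hq⟩ := ih.2.1 ⟨p⟩
        exact ⟨q, rfl, hm, h.stat_eq q ▸ hc.down, hq⟩
      · rintro ⟨q, rfl, hm, hc, hq⟩
        obtain ⟨p⟩ := ih.2.2 ⟨q, rfl, hm, hq⟩
        exact ⟨⟨(h.stat_eq q).symm ▸ hc⟩, p⟩

end Paths

section Fillings

variable {I : Type} [LinearOrder I]

theorem ncard_lefts {w : List (Token I)} (hw : SortedWord w) :
    (lefts w).ncard = leftCount w ∧ (lefts w).Finite := by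
  induction w with
  | nil => simp [leftCount]
  | cons t w ih =>
    cases t with
    | left i =>
      have hi : i ∉ lefts w := fun h => lt_irrefl _ (hw.1 i h)
      have := ih hw.2
      rw [lefts_left, Set.ncard_insert_of_notMem hi this.2]
      exact ⟨congrArg (· + 1) this.1, this.2.insert _⟩
    | right j => simpa [leftCount] using ih hw.2
    | check c => simpa [leftCount] using ih hw

theorem nestingBound_open {F : Set (I × WithTop I)} {A : Set I} {c : ℤ} {p : ℕ}
    (hF : ∀ a ∈ A, (a, ⊤) ∈ F) (hA : A = ∅ ↔ p = 0) :
    NestingBound F A {⊤} c ↔ (min p 1 : ℕ) ≤ c := by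
  constructor
  · intro h
    cases p with
    | zero => simpa using h ∅ (by simp) (by simp)
    | succ p =>
      obtain ⟨a, ha⟩ := Set.nonempty_iff_ne_empty.2 (mt hA.1 p.succ_ne_zero)
      simpa using h {(a, ⊤)} (by simpa using ⟨hF a ha, ha⟩) (by simp)
  · intro h S hS hc
    have h₁ : S.card ≤ 1 := by
      refine Finset.card_le_one.2 fun q hq r hr => ?_
      by_contra hqr
      have h₁ : q.2 = ⊤ := (hS q hq).2.2
      have h₂ : r.2 = ⊤ := (hS r hr).2.2
      rcases hc q hq r hr hqr with h | h <;> simp [h₁, h₂] at h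
    refine le_trans (Int.ofNat_le.2 (le_min ?_ h₁)) h
    cases p with
    | zero =>
      rw [Nat.le_zero, Finset.card_eq_zero, Finset.eq_empty_iff_forall_notMem]
      intro q hq
      simpa [hA.2 rfl] using (hS q hq).2.1
    | succ p => omega

theorem checks_open {F : Set (I × WithTop I)} {w : List (Token I)} (hw : rights w = ∅)
    {A : Set I} {p : ℕ} (hF : ∀ a ∈ A ∪ lefts w, (a, ⊤) ∈ F) (hA : A = ∅ ↔ p = 0) :
    Checks F A {⊤} w ↔ OpenChecks p w := by
  induction w generalizing A p with
  | nil => simp [Checks, OpenChecks]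
  | cons t w ih =>
    cases t with
    | left i =>
      refine ih (by simpa using hw) ?_ (by simp [(Set.insert_nonempty i A).ne_empty])
      simpa [or_assoc, or_left_comm] using hF
    | right j => exact absurd ((rights_right _ _).symm.trans hw) (Set.insert_nonempty _ _).ne_empty
    | check c =>
      have hw : rights w = ∅ := by simpa using hw
      refine and_congr ?_ (ih hw (by simpa using hF) hA)
      rw [hw, Set.union_empty]
      exact nestingBound_open (fun a ha => hF a (Or.inl ha)) hA

theorem filling_iff_of_rights_eq_empty {w : List (Token I)} (hw : SortedWord w)
    (hr : rights w = ∅) {m : ℕ} {F : Set (I × WithTop I)} :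
    Filling w m F ↔ F = lefts w ×ˢ {⊤} ∧ leftCount w = m ∧ OpenChecks 0 w := by
  have hn : {i | (i, ⊤) ∈ lefts w ×ˢ {(⊤ : WithTop I)}}.ncard = leftCount w := by
    simpa using (ncard_lefts hw).1
  constructor
  · intro h
    have hF : F = lefts w ×ˢ {⊤} := by
      ext ⟨i, b⟩
      constructor
      · intro hb
        have := h.mem_right _ _ hb
        rw [hr] at this
        exact ⟨h.mem_left _ _ hb, by simpa using this⟩
      · rintro ⟨hi, rfl : b = ⊤⟩
        obtain ⟨b, hb⟩ := h.exists_left i hi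
        have := h.mem_right _ _ hb
        rw [hr] at this
        obtain rfl : b = ⊤ := by simpa using this
        exact hb
    subst hF
    exact ⟨rfl, hn.symm.trans h.ncard, (checks_open hr (by simp) (by simp)).1 h.checks⟩
  · rintro ⟨rfl, hm, hc⟩
    refine ⟨by simp +contextual, by simp +contextual, by simp, by simp [hr], by simp +contextual,
      ?_, leftFirst_of_rights_eq_empty hr, hn.trans hm, (checks_open hr (by simp) (by simp)).2 hc⟩
    rintro i i' b hb ⟨-, hb'⟩
    exact absurd hb' hb

theorem isEmpty_filling_of_right (cs : List ℤ) (j : I) (v : List (Token I)) (m : ℕ) :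
    IsEmpty {F // Filling (cs.map .check ++ .right j :: v) m F} := by
  refine ⟨fun ⟨F, hF⟩ => ?_⟩
  obtain ⟨i, hi⟩ := hF.exists_right j (by simp)
  have h := hF.leftFirst
  rw [leftFirst_append] at h
  exact h.2.1.1 i (by simpa using hF.mem_left _ _ hi) hi

variable {α : Type} {up : α → α → Prop} {s : α → ℤ} {e : ℕ → α}

theorem path_equiv_filling (h : GrowthRule up s e) (m : ℕ) {w : List (Token I)}
    (hw : SortedWord w) :
    Nonempty (LabelledPath up s (w.map Token.toMove) (e 0) (e m) ≃ {F // Filling w m F}) := by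
  induction hN : inversions w using Nat.strong_induction_on generalizing w with
  | _ N ih =>
    subst hN
    rcases exists_corner w with ⟨u, i, cs, j, v, rfl⟩ | ⟨cs, j, v, rfl⟩ | hr
    · have h₁ := ih _ (inversions_flipped_lt u i cs j v) hw.flipped rfl
      have h₂ := ih _ (inversions_cancelled_lt u i cs j v) hw.cancelled rfl
      have h₃ := LabelledPath.append_equiv
        (fun x => LabelledPath.flip_equiv h cs (v.map Token.toMove) x (e m)) (u.map Token.toMove)
        (e 0)
      simp only [List.map_append, List.map_cons, map_toMove_checks, Token.toMove] at h₁ h₂ h₃ ⊢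
      exact ⟨h₃.some.trans ((Equiv.sumCongr h₁.some h₂.some).trans (filling_equiv hw m).some.symm)⟩
    · have := isEmpty_filling_of_right cs j v m
      have := LabelledPath.isEmpty_of_down h cs (v.map Token.toMove) (e m)
      simp only [List.map_append, List.map_cons, map_toMove_checks, Token.toMove]
      exact ⟨Equiv.equivOfIsEmpty _ _⟩
    · obtain ⟨h₁, h₂⟩ := LabelledPath.subsingleton_and_nonempty_iff h m hr (e 0)
      have h₃ : Subsingleton {F // Filling w m F} := by
        refine ⟨fun F F' => Subtype.ext ?_⟩
        rw [((filling_iff_of_rights_eq_empty hw hr).1 F.2).1,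
          ((filling_iff_of_rights_eq_empty hw hr).1 F'.2).1]
      have h₄ : Nonempty (LabelledPath up s (w.map Token.toMove) (e 0) (e m)) ↔
          Nonempty {F // Filling w m F} := by
        rw [h₂]
        constructor
        · rintro ⟨p, hp, hm, hc⟩
          have hp : p = 0 := by
            have := h.stat_eq p
            rw [← hp, h.stat_zero] at this
            omega
          subst hp
          exact ⟨_, (filling_iff_of_rights_eq_empty hw hr).2 ⟨rfl, by omega, hc⟩⟩
        · rintro ⟨F, hF⟩
          obtain ⟨-, hm, hc⟩ := (filling_iff_of_rights_eq_empty hw hr).1 hF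
          exact ⟨0, rfl, by omega, hc⟩
      exact ⟨⟨fun p => (h₄.1 ⟨p⟩).some, fun F => (h₄.2 ⟨F⟩).some, fun _ => Subsingleton.elim _ _,
        fun _ => Subsingleton.elim _ _⟩⟩

end Fillings

end Hesitating

namespace Hesitating

/-! ### The growth rule for Ferrers diagrams -/

theorem addBox_iff {l μ : YoungDiagram} : AddBox l μ ↔ l ≤ μ ∧ μ.card = l.card + 1 := by
  constructor
  · rintro ⟨c, hc, h⟩
    refine ⟨?_, by rw [YoungDiagram.card, h, Finset.card_insert_of_notMem hc]⟩
    rw [← YoungDiagram.cells_subset_iff, h]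
    exact Finset.subset_insert _ _
  · rintro ⟨hle, hc⟩
    rw [← YoungDiagram.cells_subset_iff] at hle
    have h : (μ.cells \ l.cells).card = 1 := by
      rw [Finset.card_sdiff_of_subset hle]
      simp only [YoungDiagram.card] at hc
      omega
    obtain ⟨c, h⟩ := Finset.card_eq_one.1 h
    refine ⟨c, fun hcl => ?_, ?_⟩
    · have : c ∈ μ.cells \ l.cells := h ▸ Finset.mem_singleton_self c
      exact (Finset.mem_sdiff.1 this).2 hcl
    · rw [← Finset.sdiff_union_of_subset hle, h, Finset.singleton_union]

theorem youngDiagram_eq_of_le_of_card_le {l μ : YoungDiagram} (h : l ≤ μ) (hc : μ.card ≤ l.card) :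
    l = μ :=
  YoungDiagram.ext (Finset.eq_of_subset_of_card_le (YoungDiagram.cells_subset_iff.2 h) hc)

theorem card_sup_add_card_inf (l μ : YoungDiagram) :
    (l ⊔ μ).card + (l ⊓ μ).card = l.card + μ.card := by
  simp only [YoungDiagram.card, YoungDiagram.cells_sup, YoungDiagram.cells_inf]
  exact Finset.card_union_add_card_inter _ _

theorem colLen_eq_iff {μ : YoungDiagram} {j n : ℕ} :
    μ.colLen j = n ↔ ∀ i, (i, j) ∈ μ ↔ i < n := by
  simp only [YoungDiagram.mem_iff_lt_colLen]
  exact ⟨fun h i => h ▸ Iff.rfl, fun h => eq_of_forall_lt_iff h⟩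

theorem colLen_sup (l μ : YoungDiagram) (j : ℕ) :
    (l ⊔ μ).colLen j = max (l.colLen j) (μ.colLen j) := by
  rw [colLen_eq_iff]
  intro i
  rw [YoungDiagram.mem_sup, YoungDiagram.mem_iff_lt_colLen, YoungDiagram.mem_iff_lt_colLen,
    lt_max_iff]

section Columns

variable (x : YoungDiagram)

/-- A box can be added to the column `j`. -/
def Addable (j : ℕ) : Prop := ∀ p, j = p + 1 → x.colLen j < x.colLen p

/-- A box can be removed from the column `j`. -/
def Removable (j : ℕ) : Prop := x.colLen (j + 1) < x.colLen j

theorem addable_zero : Addable x 0 := fun p h => by omega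

theorem addable_succ (j : ℕ) : Addable x (j + 1) ↔ Removable x j :=
  ⟨fun h => h j rfl, fun h _ hp => Nat.succ.inj hp ▸ h⟩

variable {x}

/-- Add a box to the column `j`. -/
def addCol (j : ℕ) (h : Addable x j) : YoungDiagram where
  cells := insert (x.colLen j, j) x.cells
  isLowerSet := by
    rintro ⟨a, b⟩ ⟨a', b'⟩ ⟨ha : a' ≤ a, hb : b' ≤ b⟩ hab
    simp only [Finset.coe_insert, Set.mem_insert_iff, Prod.mk.injEq, SetLike.mem_coe,
      YoungDiagram.mem_cells, YoungDiagram.mem_iff_lt_colLen] at hab ⊢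
    have h₁ := x.colLen_anti b' b hb
    rcases hab with ⟨rfl, rfl⟩ | hab
    · rcases hb.eq_or_lt with rfl | hb
      · omega
      · have h₂ := h (b - 1) (by omega)
        have h₃ := x.colLen_anti b' (b - 1) (by omega)
        omega
    · omega

/-- Remove a box from the column `j`. -/
def removeCol (j : ℕ) (h : Removable x j) : YoungDiagram where
  cells := x.cells.erase (x.colLen j - 1, j)
  isLowerSet := by
    rintro ⟨a, b⟩ ⟨a', b'⟩ ⟨ha : a' ≤ a, hb : b' ≤ b⟩ hab
    simp only [Finset.coe_erase, Set.mem_sdiff, Set.mem_singleton_iff, Prod.mk.injEq,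
      SetLike.mem_coe, YoungDiagram.mem_cells, YoungDiagram.mem_iff_lt_colLen] at hab ⊢
    have h₁ := x.colLen_anti b' b hb
    refine ⟨by omega, ?_⟩
    rintro ⟨rfl, rfl⟩
    unfold Removable at h
    rcases hb.eq_or_lt with rfl | hb
    · omega
    · have := x.colLen_anti (b' + 1) b hb
      omega

theorem addBox_addCol (j : ℕ) (h : Addable x j) : AddBox x (addCol j h) :=
  ⟨(x.colLen j, j), by simp [YoungDiagram.mem_iff_lt_colLen], rfl⟩

theorem addBox_removeCol (j : ℕ) (h : Removable x j) : AddBox (removeCol j h) x := by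
  refine ⟨(x.colLen j - 1, j), Finset.notMem_erase _ _, (Finset.insert_erase ?_).symm⟩
  rw [YoungDiagram.mem_cells, YoungDiagram.mem_iff_lt_colLen]
  unfold Removable at h
  omega

theorem exists_eq_addCol {z : YoungDiagram} (hz : AddBox x z) :
    ∃ j, ∃ h : Addable x j, z = addCol j h := by
  obtain ⟨⟨i, j⟩, hc, hz⟩ := hz
  have hmem : ∀ c, c ∈ z ↔ c = (i, j) ∨ c ∈ x := fun c => by
    rw [← YoungDiagram.mem_cells, hz, Finset.mem_insert, YoungDiagram.mem_cells]
  rw [YoungDiagram.mem_cells, YoungDiagram.mem_iff_lt_colLen] at hc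
  have hi : i = x.colLen j := by
    by_contra hne
    have := z.up_left_mem (i1 := x.colLen j) (j1 := j) (by omega : _ ≤ i) le_rfl
      ((hmem _).2 (Or.inl rfl))
    simp only [hmem, Prod.mk.injEq, YoungDiagram.mem_iff_lt_colLen] at this
    omega
  subst hi
  refine ⟨j, fun p hp => ?_, YoungDiagram.ext hz⟩
  have := z.up_left_mem (j1 := p) le_rfl (by omega : p ≤ j) ((hmem _).2 (Or.inl rfl))
  simp only [hmem, Prod.mk.injEq, YoungDiagram.mem_iff_lt_colLen] at this
  omega

theorem exists_eq_removeCol {r : YoungDiagram} (hr : AddBox r x) :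
    ∃ j, ∃ h : Removable x j, r = removeCol j h := by
  obtain ⟨⟨i, j⟩, hc, hx⟩ := hr
  have hmem : ∀ c, c ∈ x ↔ c = (i, j) ∨ c ∈ r := fun c => by
    rw [← YoungDiagram.mem_cells, hx, Finset.mem_insert, YoungDiagram.mem_cells]
  have hi : i < x.colLen j := YoungDiagram.mem_iff_lt_colLen.1 ((hmem _).2 (Or.inl rfl))
  have key : ∀ c, (i, j) ≤ c → c ≠ (i, j) → c ∉ x := fun c hle hne hcx =>
    hc (r.isLowerSet hle (((hmem _).1 hcx).resolve_left hne))
  have h₁ := key (i + 1, j) ⟨by simp, le_rfl⟩ (by simp)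
  have h₂ := key (i, j + 1) ⟨le_rfl, by simp⟩ (by simp)
  rw [YoungDiagram.mem_iff_lt_colLen] at h₁ h₂
  obtain rfl : i = x.colLen j - 1 := by omega
  refine ⟨j, by unfold Removable; omega, YoungDiagram.ext ?_⟩
  change r.cells = x.cells.erase _
  rw [hx, Finset.erase_insert hc]

theorem addCol_injective {j j' : ℕ} {h : Addable x j} {h' : Addable x j'}
    (heq : addCol j h = addCol j' h') : j = j' := by
  have : (x.colLen j, j) ∈ addCol j' h' := heq ▸ Finset.mem_insert_self _ _
  rcases Finset.mem_insert.1 this with h | h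
  · exact (Prod.mk.inj h).2
  · simp [YoungDiagram.mem_iff_lt_colLen] at h

theorem removeCol_injective {j j' : ℕ} {h : Removable x j} {h' : Removable x j'}
    (heq : removeCol j h = removeCol j' h') : j = j' := by
  by_contra hne
  have : (x.colLen j - 1, j) ∈ removeCol j' h' := by
    refine Finset.mem_erase.2 ⟨by simp [hne], ?_⟩
    rw [YoungDiagram.mem_cells, YoungDiagram.mem_iff_lt_colLen]
    unfold Removable at h
    omega
  rw [← heq] at this
  exact (Finset.mem_erase.1 this).1 rfl

theorem colLen_zero_addCol (j : ℕ) (h : Addable x j) :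
    (addCol j h).colLen 0 = x.colLen 0 + if j = 0 then 1 else 0 := by
  rw [colLen_eq_iff]
  intro i
  rw [← YoungDiagram.mem_cells]
  simp only [addCol, Finset.mem_insert, Prod.mk.injEq, YoungDiagram.mem_cells,
    YoungDiagram.mem_iff_lt_colLen]
  split_ifs with hj
  · subst hj
    omega
  · omega

/-- The first-column statistic of Ferrers diagrams. -/
abbrev firstCol (μ : YoungDiagram) : ℤ := μ.colLen 0

noncomputable def addBoxEquiv (cs : List ℤ) :
    {j // Addable x j ∧ ∀ c ∈ cs, firstCol x + (if j = 0 then 1 else 0) ≤ c} ≃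
      {z // AddBox x z ∧ AddBox x z ∧ ∀ c ∈ cs, firstCol z ≤ c} :=
  Equiv.ofBijective
    (fun j => ⟨addCol j.1 j.2.1, addBox_addCol _ _, addBox_addCol _ _, by
      have := j.2.2
      simpa [firstCol, colLen_zero_addCol] using this⟩) <| by
    constructor
    · intro j j' h
      exact Subtype.ext (addCol_injective (h := j.2.1) (h' := j'.2.1) (congrArg Subtype.val h))
    · rintro ⟨z, hz, -, hc⟩
      obtain ⟨j, hj, rfl⟩ := exists_eq_addCol hz
      exact ⟨⟨j, hj, by simpa [firstCol, colLen_zero_addCol] using hc⟩, rfl⟩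

noncomputable def removeBoxEquiv (cs : List ℤ) :
    {j // Removable x j ∧ ∀ c ∈ cs, firstCol x ≤ c} ≃
      {r // AddBox r x ∧ AddBox r x ∧ ∀ c ∈ cs, firstCol x ≤ c ∧ firstCol x ≤ c} :=
  Equiv.ofBijective
    (fun j => ⟨removeCol j.1 j.2.1, addBox_removeCol _ _, addBox_removeCol _ _,
      fun c hc => ⟨j.2.2 c hc, j.2.2 c hc⟩⟩) <| by
    constructor
    · intro j j' h
      exact Subtype.ext (removeCol_injective (h := j.2.1) (h' := j'.2.1) (congrArg Subtype.val h))
    · rintro ⟨r, hr, -, hc⟩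
      obtain ⟨j, hj, rfl⟩ := exists_eq_removeCol hr
      exact ⟨⟨j, hj, fun c h => (hc c h).1⟩, rfl⟩

end Columns

/-- Split off zero from a set of natural numbers. -/
def natSubtypeEquiv (Q : ℕ → Prop) : {j // Q j} ≃ {j // Q (j + 1)} ⊕ {_u : Unit // Q 0} where
  toFun
    | ⟨0, h⟩ => Sum.inr ⟨(), h⟩
    | ⟨j + 1, h⟩ => Sum.inl ⟨j, h⟩
  invFun
    | Sum.inl j => ⟨j.1 + 1, j.2⟩
    | Sum.inr u => ⟨0, u.2⟩
  left_inv := by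
    rintro ⟨_ | j, h⟩ <;> rfl
  right_inv := by
    rintro (⟨j, h⟩ | ⟨u, h⟩) <;> rfl

theorem flip_self (x : YoungDiagram) (cs : List ℤ) :
    Nonempty ({z // AddBox x z ∧ AddBox x z ∧ ∀ c ∈ cs, firstCol z ≤ c} ≃
      {r // AddBox r x ∧ AddBox r x ∧ ∀ c ∈ cs, firstCol x ≤ c ∧ firstCol x ≤ c} ⊕
        {_u : Unit // x = x ∧ ∀ c ∈ cs, firstCol x ≤ c - 1}) := by
  refine ⟨(addBoxEquiv cs).symm.trans ((natSubtypeEquiv _).trans (Equiv.sumCongr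
    ((Equiv.subtypeEquivRight fun j => ?_).trans (removeBoxEquiv cs))
    (Equiv.subtypeEquivRight fun u => ?_)))⟩
  · simp [addable_succ]
  · simp [addable_zero, le_sub_iff_add_le]

theorem eq_sup_of_addBox {x y z : YoungDiagram} (hne : x ≠ y) (hx : AddBox x z) (hy : AddBox y z) :
    z = x ⊔ y := by
  rw [addBox_iff] at hx hy
  refine (youngDiagram_eq_of_le_of_card_le (sup_le hx.1 hy.1) ?_).symm
  by_contra! h
  exact hne ((youngDiagram_eq_of_le_of_card_le le_sup_left (by omega)).trans
    (youngDiagram_eq_of_le_of_card_le le_sup_right (by omega)).symm)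

theorem eq_inf_of_addBox {x y r : YoungDiagram} (hne : x ≠ y) (hx : AddBox r x) (hy : AddBox r y) :
    r = x ⊓ y := by
  rw [addBox_iff] at hx hy
  refine youngDiagram_eq_of_le_of_card_le (le_inf hx.1 hy.1) ?_
  by_contra! h
  exact hne ((youngDiagram_eq_of_le_of_card_le inf_le_left (by omega)).symm.trans
    (youngDiagram_eq_of_le_of_card_le inf_le_right (by omega)))

theorem addBox_inf_iff_addBox_sup {x y : YoungDiagram} :
    AddBox (x ⊓ y) x ∧ AddBox (x ⊓ y) y ↔ AddBox x (x ⊔ y) ∧ AddBox y (x ⊔ y) := by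
  have := card_sup_add_card_inf x y
  simp only [addBox_iff, inf_le_left, inf_le_right, le_sup_left, le_sup_right, true_and]
  omega

theorem flip_of_ne {x y : YoungDiagram} (hne : x ≠ y) (cs : List ℤ) :
    Nonempty ({z // AddBox x z ∧ AddBox y z ∧ ∀ c ∈ cs, firstCol z ≤ c} ≃
      {r // AddBox r x ∧ AddBox r y ∧ ∀ c ∈ cs, firstCol x ≤ c ∧ firstCol y ≤ c} ⊕
        {_u : Unit // x = y ∧ ∀ c ∈ cs, firstCol x ≤ c - 1}) := by
  have : IsEmpty {_u : Unit // x = y ∧ ∀ c ∈ cs, firstCol x ≤ c - 1} := ⟨fun u => hne u.2.1⟩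
  have hs : (∀ c ∈ cs, firstCol (x ⊔ y) ≤ c) ↔ ∀ c ∈ cs, firstCol x ≤ c ∧ firstCol y ≤ c := by
    simp [firstCol, colLen_sup]
  refine ⟨Equiv.trans ?_ (Equiv.sumEmpty _ _).symm⟩
  refine
    { toFun := fun z => ⟨x ⊓ y, ?_⟩
      invFun := fun r => ⟨x ⊔ y, ?_⟩
      left_inv := fun z => Subtype.ext (eq_sup_of_addBox hne z.2.1 z.2.2.1).symm
      right_inv := fun r => Subtype.ext (eq_inf_of_addBox hne r.2.1 r.2.2.1).symm }
  · obtain ⟨z, h₁, h₂, h₃⟩ := z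
    obtain rfl := eq_sup_of_addBox hne h₁ h₂
    rw [← and_assoc, addBox_inf_iff_addBox_sup]
    exact ⟨⟨h₁, h₂⟩, hs.1 h₃⟩
  · obtain ⟨z, h₁, h₂, h₃⟩ := r
    obtain rfl := eq_inf_of_addBox hne h₁ h₂
    rw [← and_assoc, ← addBox_inf_iff_addBox_sup]
    exact ⟨⟨h₁, h₂⟩, hs.2 h₃⟩

/-- The one-row shape `(m)`. -/
def rowDiagram (m : ℕ) : YoungDiagram where
  cells := {0} ×ˢ Finset.range m
  isLowerSet := by
    rintro ⟨a, b⟩ ⟨a', b'⟩ ⟨ha : a' ≤ a, hb : b' ≤ b⟩ hab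
    simp only [Finset.coe_product, Finset.coe_singleton, Set.mem_prod, Set.mem_singleton_iff,
      SetLike.mem_coe, Finset.mem_range] at hab ⊢
    omega

theorem mem_rowDiagram {m i j : ℕ} : (i, j) ∈ rowDiagram m ↔ i = 0 ∧ j < m := by
  rw [← YoungDiagram.mem_cells]
  simp [rowDiagram, and_comm, eq_comm]

theorem rowDiagram_zero : rowDiagram 0 = ⊥ := by
  ext ⟨i, j⟩
  simp [mem_rowDiagram]

theorem addBox_rowDiagram_iff (x : YoungDiagram) (m : ℕ) :
    AddBox x (rowDiagram m) ↔ ∃ p, m = p + 1 ∧ x = rowDiagram p := by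
  constructor
  · rintro ⟨⟨i, j⟩, hc, h⟩
    have hmem : ∀ a b, (a, b) ∈ rowDiagram m ↔ (a = i ∧ b = j) ∨ (a, b) ∈ x := fun a b => by
      rw [← YoungDiagram.mem_cells, h, Finset.mem_insert, YoungDiagram.mem_cells, Prod.mk.injEq]
    simp only [mem_rowDiagram] at hmem
    have h₁ := (hmem i j).2 (Or.inl ⟨rfl, rfl⟩)
    obtain rfl := h₁.1
    have h₂ : m = j + 1 := by
      by_contra hne
      have h₃ := ((hmem 0 (j + 1)).1 ⟨rfl, by omega⟩).resolve_left (by omega)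
      exact hc (x.up_left_mem le_rfl (Nat.le_succ j) h₃)
    refine ⟨j, h₂, ?_⟩
    ext ⟨a, b⟩
    have := hmem a b
    rw [YoungDiagram.mem_cells] at hc
    simp only [YoungDiagram.mem_cells, mem_rowDiagram]
    constructor
    · intro hab
      have h₃ : ¬ (a = 0 ∧ b = j) := by
        rintro ⟨rfl, rfl⟩
        exact hc hab
      have := this.2 (Or.inr hab)
      omega
    · intro hab
      exact (this.1 (by omega)).resolve_left (by omega)
  · rintro ⟨p, rfl, rfl⟩
    refine ⟨(0, p), by simp [mem_rowDiagram], ?_⟩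
    ext ⟨a, b⟩
    simp only [YoungDiagram.mem_cells, mem_rowDiagram, Finset.mem_insert, Prod.mk.injEq]
    omega

theorem growthRule_addBox : GrowthRule AddBox firstCol rowDiagram where
  flip x y cs := by
    by_cases h : x = y
    · subst h
      exact flip_self x cs
    · exact flip_of_ne h cs
  up_iff := addBox_rowDiagram_iff
  stat_zero := by
    have : (rowDiagram 0).colLen 0 = 0 := colLen_eq_iff.2 (by simp [mem_rowDiagram])
    simp [firstCol, this]
  stat_succ m := by
    have : (rowDiagram (m + 1)).colLen 0 = 1 := colLen_eq_iff.2 (by simp [mem_rowDiagram])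
    simp [firstCol, this]

end Hesitating

namespace Hesitating

/-! ### Hesitating sequences as labelled paths -/

/-- The kind of a vertex: the left endpoint of an arc only, the right endpoint of an arc only, or
both (possibly of a loop). -/
inductive Kind
  | opener
  | closer
  | both

/-- The pairs of moves of a hesitating sequence of the given kind. -/
def Kind.Step {α : Type} (up : α → α → Prop) : Kind → α → α → α → Prop
  | .opener, x, y, z => y = x ∧ up y z
  | .closer, x, y, z => up y x ∧ z = y
  | .both, x, y, z => up x y ∧ up z y

/-- The moves of a labelled path that correspond to a pair of moves of the given kind. -/
def Kind.moves (k : ℤ) : Kind → List Move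
  | .opener => [.up, .check k]
  | .closer => [.down, .check k]
  | .both => [.up, .check k, .down, .check k]

variable {α : Type} (up : α → α → Prop) (s : α → ℤ) (k : ℤ)

/-- The hesitating sequences from `x` to `y` whose pairs of moves have the kinds `t`. -/
def kindSequences {n : ℕ} (t : Fin n → Kind) (x y : α) : Set (Fin (2 * n + 1) → α) :=
  {f | f 0 = x ∧ f (Fin.last _) = y ∧ (∀ i, s (f i) ≤ k) ∧
    ∀ i : Fin n, (t i).Step up (f ⟨2 * i, by omega⟩) (f ⟨2 * i + 1, by omega⟩)
      (f ⟨2 * i + 2, by omega⟩)}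

/-- Put two points in front of a sequence. -/
def consTwo {n : ℕ} (x y : α) (g : Fin (2 * n + 1) → α) : Fin (2 * (n + 1) + 1) → α
  | ⟨0, _⟩ => x
  | ⟨1, _⟩ => y
  | ⟨i + 2, h⟩ => g ⟨i, by omega⟩

variable {up s k}

def kindSequencesConsEquiv {n : ℕ} (t : Fin (n + 1) → Kind) {x : α} (hx : s x ≤ k) (y : α) :
    kindSequences up s k t x y ≃
      Σ p : {p : α × α // (t 0).Step up x p.1 p.2 ∧ s p.1 ≤ k ∧ s p.2 ≤ k},
        kindSequences up s k (fun i => t i.succ) p.1.2 y where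
  toFun f := ⟨⟨(f.1 ⟨1, by omega⟩, f.1 ⟨2, by omega⟩),
      by simpa [f.2.1] using f.2.2.2.2 0, f.2.2.2.1 _, f.2.2.2.1 _⟩,
    fun i => f.1 ⟨i + 2, by omega⟩, rfl, f.2.2.1, fun i => f.2.2.2.1 _, fun i => f.2.2.2.2 i.succ⟩
  invFun p := ⟨consTwo x p.1.1.1 p.2.1, rfl, p.2.2.2.1, by
      rintro ⟨_ | _ | i, h⟩
      exacts [hx, p.1.2.2.1, p.2.2.2.2.1 _], by
      intro i
      refine Fin.cases ?_ (fun i => ?_) i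
      · have h := p.1.2.1
        rw [← p.2.2.1] at h
        exact h
      · exact p.2.2.2.2.2 i⟩
  left_inv f := Subtype.ext <| by
    funext i
    obtain ⟨_ | _ | i, h⟩ := i
    exacts [f.2.1.symm, rfl, rfl]
  right_inv := by
    rintro ⟨⟨⟨a, b⟩, h⟩, g, hg⟩
    have hb : g 0 = b := hg.1
    subst hb
    rfl

def LabelledPath.kindEquiv (t : Kind) (w : List Move) (x y : α) (hx : s x ≤ k) :
    LabelledPath up s (t.moves k ++ w) x y ≃
      Σ p : {p : α × α // t.Step up x p.1 p.2 ∧ s p.1 ≤ k ∧ s p.2 ≤ k},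
        LabelledPath up s w p.1.2 y :=
  match t with
  | .opener =>
    { toFun := fun p => ⟨⟨(x, p.1.1), ⟨rfl, p.1.2⟩, hx, p.2.1.down⟩, p.2.2⟩
      invFun := fun p => ⟨⟨p.1.1.2,
        Eq.subst (motive := fun a => up a p.1.1.2) p.1.2.1.1 p.1.2.1.2⟩, ⟨p.1.2.2.2⟩, p.2⟩
      left_inv := fun _ => rfl
      right_inv := by
        rintro ⟨⟨⟨a, b⟩, h⟩, p⟩
        have ha : a = x := h.1.1
        subst ha
        rfl }
  | .closer =>
    { toFun := fun p => ⟨⟨(p.1.1, p.1.1), ⟨p.1.2, rfl⟩, p.2.1.down, p.2.1.down⟩, p.2.2⟩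
      invFun := fun p => ⟨⟨p.1.1.2,
        Eq.subst (motive := fun a => up a x) p.1.2.1.2.symm p.1.2.1.1⟩, ⟨p.1.2.2.2⟩, p.2⟩
      left_inv := fun _ => rfl
      right_inv := by
        rintro ⟨⟨⟨a, b⟩, h⟩, p⟩
        have hb : b = a := h.1.2
        subst hb
        rfl }
  | .both =>
    { toFun := fun p => ⟨⟨(p.1.1, p.2.2.1.1), ⟨p.1.2, p.2.2.1.2⟩, p.2.1.down, p.2.2.2.1.down⟩,
        p.2.2.2.2⟩
      invFun := fun p => ⟨⟨p.1.1.1, p.1.2.1.1⟩, ⟨p.1.2.2.1⟩, ⟨p.1.1.2, p.1.2.1.2⟩, ⟨p.1.2.2.2⟩, p.2⟩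
      left_inv := fun _ => rfl
      right_inv := fun _ => rfl }

theorem kindSequences_equiv_path {n : ℕ} (t : Fin n → Kind) {x : α} (hx : s x ≤ k) (y : α) :
    Nonempty (kindSequences up s k t x y ≃
      LabelledPath up s ((List.ofFn t).flatMap (Kind.moves k)) x y) := by
  induction n generalizing x with
  | zero =>
    refine ⟨⟨fun f => ⟨f.2.1.symm.trans f.2.2.1⟩, fun h => ⟨fun _ => x, rfl, h.down, fun _ => hx,
      fun i => i.elim0⟩, fun f => Subtype.ext ?_, fun _ => rfl⟩⟩
    funext i
    obtain rfl : i = 0 := Fin.ext (by omega)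
    exact f.2.1.symm
  | succ n ih =>
    rw [List.ofFn_succ, List.flatMap_cons]
    exact ⟨(kindSequencesConsEquiv t hx y).trans <|
      (Equiv.sigmaCongrRight fun p => (ih (fun i => t i.succ) p.2.2.2).some).trans
      (LabelledPath.kindEquiv (t 0) _ x y hx).symm⟩

theorem isHesitating_iff {n : ℕ} (f : Fin (2 * n + 1) → α) :
    IsHesitating up f ↔ ∃ t : Fin n → Kind, ∀ i : Fin n, (t i).Step up (f ⟨2 * i, by omega⟩)
      (f ⟨2 * i + 1, by omega⟩) (f ⟨2 * i + 2, by omega⟩) := by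
  rw [← Classical.skolem (p := fun (i : Fin n) t => Kind.Step up t (f ⟨2 * i, by omega⟩)
    (f ⟨2 * i + 1, by omega⟩) (f ⟨2 * i + 2, by omega⟩))]
  refine forall_congr' fun i => ⟨?_, ?_⟩
  · rintro (h | h | h)
    exacts [⟨.opener, h⟩, ⟨.closer, h⟩, ⟨.both, h⟩]
  · rintro ⟨_ | _ | _, h⟩
    exacts [Or.inl h, Or.inr (Or.inl h), Or.inr (Or.inr h)]

theorem not_addBox_self (x : YoungDiagram) : ¬ AddBox x x := fun h => by
  have := (addBox_iff.1 h).2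
  omega

theorem Kind.eq_of_step {t t' : Kind} {x y z : YoungDiagram} (h : t.Step AddBox x y z)
    (h' : t'.Step AddBox x y z) : t = t' := by
  have hs := not_addBox_self
  cases t <;> cases t' <;> simp only [Kind.Step] at h h' <;> first | rfl | grind

theorem tableaux_equiv_sigma_path (k n m : ℕ) :
    Nonempty (tableaux k n m ≃ Σ t : Fin n → Kind, LabelledPath AddBox firstCol
      ((List.ofFn t).flatMap (Kind.moves k)) (rowDiagram 0) (rowDiagram m)) := by
  have h₀ : firstCol (rowDiagram 0) ≤ (k : ℤ) := by
    rw [growthRule_addBox.stat_zero]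
    omega
  refine ⟨Equiv.trans ?_ (Equiv.sigmaCongrRight fun t =>
    (kindSequences_equiv_path t h₀ (rowDiagram m)).some)⟩
  refine (Equiv.ofBijective (fun f => ⟨f.2.1, (isHesitating_iff _).2 ⟨f.1, f.2.2.2.2.2⟩,
    f.2.2.1.trans rowDiagram_zero, fun i => Int.ofNat_le.1 (f.2.2.2.2.1 i),
    congrArg YoungDiagram.cells f.2.2.2.1⟩) ⟨?_, ?_⟩).symm
  · rintro ⟨t, f, hf⟩ ⟨t', f', hf'⟩ h
    obtain rfl : f = f' := congrArg Subtype.val h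
    exact Sigma.subtype_ext (funext fun i => Kind.eq_of_step (hf.2.2.2 i) (hf'.2.2.2 i)) rfl
  · rintro ⟨f, h₁, h₂, h₃, h₄⟩
    obtain ⟨t, ht⟩ := (isHesitating_iff f).1 h₁
    exact ⟨⟨t, f, h₂.trans rowDiagram_zero.symm, YoungDiagram.ext h₄,
      fun i => Int.ofNat_le.2 (h₃ i), ht⟩, rfl⟩

end Hesitating

namespace Hesitating

/-! ### Open partition diagrams as fillings -/

/-- The letters of a word that correspond to a vertex `i` of the given kind. -/
def Kind.tokens {I : Type} (k : ℤ) (i : I) : Kind → List (Token I)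
  | .opener => [.left i, .check k]
  | .closer => [.right i, .check k]
  | .both => [.left i, .check k, .right i, .check k]

/-- The word of a list of vertices with given kinds. -/
def kindWord {I : Type} (k : ℤ) (t : I → Kind) (l : List I) : List (Token I) :=
  l.flatMap fun i => (t i).tokens k i

theorem map_toMove_kindWord {n : ℕ} (k : ℤ) (t : Fin n → Kind) :
    (kindWord k t (List.finRange n)).map Token.toMove =
      (List.ofFn t).flatMap (Kind.moves k) := by
  rw [kindWord, List.map_flatMap, List.ofFn_eq_map, List.flatMap_map]
  refine congrArg (fun f => List.flatMap f _) (funext fun i => ?_)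
  cases t i <;> rfl

section kindWord

variable {I : Type} (k : ℤ) (t : I → Kind)

theorem mem_lefts_tokens {c : Kind} {i a : I} :
    a ∈ lefts (c.tokens k i) ↔ a = i ∧ c ≠ .closer := by
  cases c <;> simp [Kind.tokens]

theorem mem_rights_tokens {c : Kind} {i : I} {b : WithTop I} :
    b ∈ rights (c.tokens k i) ↔ b = i ∧ c ≠ .opener := by
  cases c <;> simp [Kind.tokens]

theorem mem_lefts_kindWord {l : List I} {a : I} :
    a ∈ lefts (kindWord k t l) ↔ a ∈ l ∧ t a ≠ .closer := by
  induction l with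
  | nil => simp [kindWord]
  | cons i l ih =>
    rw [kindWord, List.flatMap_cons, ← kindWord, lefts_append, Set.mem_union, ih,
      mem_lefts_tokens, List.mem_cons]
    grind

theorem mem_rights_kindWord {l : List I} {b : WithTop I} :
    b ∈ rights (kindWord k t l) ↔ ∃ j : I, b = j ∧ j ∈ l ∧ t j ≠ .opener := by
  induction l with
  | nil => simp [kindWord]
  | cons i l ih =>
    rw [kindWord, List.flatMap_cons, ← kindWord, rights_append, Set.mem_union, ih,
      mem_rights_tokens]
    simp only [List.mem_cons]
    grind

theorem check_mem_kindWord {l : List I} {c : ℤ} (h : .check c ∈ kindWord k t l) : c = k := by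
  obtain ⟨i, -, hi⟩ := List.mem_flatMap.1 h
  cases hti : t i <;> simpa [hti, Kind.tokens] using hi

variable [LinearOrder I]

theorem sortedWord_kindWord {l : List I} (hl : l.Pairwise (· < ·)) :
    SortedWord (kindWord k t l) := by
  induction l with
  | nil => trivial
  | cons i l ih =>
    rw [List.pairwise_cons] at hl
    rw [kindWord, List.flatMap_cons, ← kindWord, sortedWord_append]
    refine ⟨?_, ih hl.2, fun a ha b hb => ?_, fun a ha b hb => ?_⟩
    · cases t i <;> simp [Kind.tokens, SortedWord]
    · rw [mem_lefts_tokens] at ha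
      rw [mem_lefts_kindWord] at hb
      exact ha.1 ▸ hl.1 b hb.1
    · rw [mem_rights_tokens] at ha
      obtain ⟨j, rfl, hj, -⟩ := (mem_rights_kindWord k t).1 hb
      rw [ha.1]
      exact WithTop.coe_lt_coe.2 (hl.1 j hj)

theorem leftFirst_kindWord {l : List I} (hl : l.Pairwise (· < ·)) {F : Set (I × WithTop I)} :
    LeftFirst F (kindWord k t l) ↔ ∀ i ∈ l, ∀ j ∈ l, t i ≠ .closer → t j ≠ .opener →
      (i, (j : WithTop I)) ∈ F → i ≤ j := by
  induction l with
  | nil => simp [kindWord, LeftFirst]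
  | cons a l ih =>
    rw [List.pairwise_cons] at hl
    rw [kindWord, List.flatMap_cons, ← kindWord, leftFirst_append, ih hl.2]
    have h : LeftFirst F ((t a).tokens k a) := by
      cases t a <;> simp [Kind.tokens, LeftFirst]
    simp only [h, true_and, mem_rights_tokens, mem_lefts_kindWord, List.forall_mem_cons, le_refl,
      implies_true]
    constructor
    · rintro ⟨h₁, h₂⟩
      refine ⟨fun j hj _ _ _ => (hl.1 j hj).le, fun i hi => ⟨fun h₃ h₄ h₅ => ?_, h₁ i hi⟩⟩
      exact absurd h₅ (h₂ _ ⟨rfl, h₄⟩ _ ⟨hi, h₃⟩)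
    · rintro ⟨-, h₂⟩
      refine ⟨fun i hi => (h₂ i hi).2, ?_⟩
      rintro b ⟨rfl, h₄⟩ i ⟨hi, h₃⟩ h₅
      exact ((h₂ i hi).1 h₃ h₄ h₅).not_gt (hl.1 i hi)

theorem checks_of_nestingBound {F : Set (I × WithTop I)} {A : Set I} {B : Set (WithTop I)}
    {w : List (Token I)} (h : ∀ c, .check c ∈ w → NestingBound F Set.univ Set.univ c) :
    Checks F A B w := by
  induction w generalizing A with
  | nil => trivial
  | cons x w ih =>
    have ih {A} := ih (A := A) fun c hc => h c (List.mem_cons_of_mem _ hc)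
    cases x with
    | left i => exact ih
    | right j => exact ih
    | check c => exact ⟨(h c List.mem_cons_self).mono fun p hp => ⟨hp.1, trivial, trivial⟩, ih⟩

variable {k t} in
theorem nestingBound_of_checks {l : List I} (hl : l.Pairwise (· < ·)) {F : Set (I × WithTop I)}
    (h : Checks F ∅ {⊤} (kindWord k t l)) {i : I} (hi : i ∈ l) (hti : t i ≠ .closer) :
    NestingBound F {a | a ∈ lefts (kindWord k t l) ∧ a ≤ i}
      {b | (b = ⊤ ∨ b ∈ rights (kindWord k t l)) ∧ i ≤ b} k := by
  obtain ⟨l₁, l₂, rfl⟩ := List.append_of_mem hi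
  rw [List.pairwise_append, List.pairwise_cons] at hl
  obtain ⟨-, ⟨hl₂, -⟩, hl₁⟩ := hl
  obtain ⟨r, hr⟩ : ∃ r, (t i).tokens k i = .left i :: .check k :: r := by
    cases hti' : t i with
    | opener => exact ⟨_, rfl⟩
    | closer => exact absurd hti' hti
    | both => exact ⟨_, rfl⟩
  have hw : kindWord k t (l₁ ++ i :: l₂) =
      kindWord k t l₁ ++ .left i :: .check k :: (r ++ kindWord k t l₂) := by
    simp only [kindWord, List.flatMap_append, List.flatMap_cons, hr, List.cons_append]
  have hr' : rights r = rights ((t i).tokens k i) := by simp [hr]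
  rw [hw, checks_append] at h
  refine h.2.1.mono ?_
  rintro ⟨a, b⟩ ⟨hF, ⟨ha, hai⟩, hb, hib⟩
  refine ⟨hF, ?_, ?_⟩
  · rw [mem_lefts_kindWord, List.mem_append, List.mem_cons] at ha
    obtain ⟨ha | rfl | ha, hta⟩ := ha
    · exact Or.inr (Or.inr ((mem_lefts_kindWord k t).2 ⟨ha, hta⟩))
    · exact Or.inl rfl
    · exact absurd (hl₂ a ha) hai.not_gt
  · rcases hb with rfl | hb
    · exact Or.inl rfl
    · refine Or.inr ?_
      obtain ⟨j, rfl, hj, htj⟩ := (mem_rights_kindWord k t).1 hb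
      rw [List.mem_append, List.mem_cons] at hj
      rw [rights_append, hr']
      obtain hj | rfl | hj := hj
      · exact absurd (hl₁ j hj i List.mem_cons_self) (WithTop.coe_le_coe.1 hib).not_gt
      · exact Or.inl ((mem_rights_tokens k).2 ⟨rfl, htj⟩)
      · exact Or.inr ((mem_rights_kindWord k t).2 ⟨j, rfl, hj, htj⟩)

end kindWord

section Fin

variable {n m k : ℕ} {F : Set (Fin n × WithTop (Fin n))} {t : Fin n → Kind}

theorem filling_kindWord_iff :
    Filling (kindWord k t (List.finRange n)) m F ↔
      (∀ i b, (i, b) ∈ F → t i ≠ .closer) ∧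
      (∀ i (j : Fin n), (i, (j : WithTop (Fin n))) ∈ F → t j ≠ .opener ∧ i ≤ j) ∧
      (∀ i, t i ≠ .closer → ∃ b, (i, b) ∈ F) ∧
      (∀ j, t j ≠ .opener → ∃ i, (i, (j : WithTop (Fin n))) ∈ F) ∧
      (∀ i b b', (i, b) ∈ F → (i, b') ∈ F → b = b') ∧
      (∀ i i' (j : Fin n), (i, (j : WithTop (Fin n))) ∈ F → (i', (j : WithTop (Fin n))) ∈ F →
        i = i') ∧
      {i | (i, (⊤ : WithTop (Fin n))) ∈ F}.ncard = m ∧ NestingBound F Set.univ Set.univ k := by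
  have hl : (List.finRange n).Pairwise (· < ·) := List.pairwise_lt_finRange n
  constructor
  · rintro ⟨h₁, h₂, h₃, h₄, h₅, h₆, h₇, h₈, h₉⟩
    rw [leftFirst_kindWord _ _ hl] at h₇
    simp only [mem_lefts_kindWord, mem_rights_kindWord, List.mem_finRange, true_and] at h₁ h₂ h₃ h₄
    have h₂' : ∀ i (j : Fin n), (i, (j : WithTop (Fin n))) ∈ F → t j ≠ .opener := by
      intro i j hij
      rcases h₂ i j hij with h | ⟨j', h, h'⟩
      · exact absurd h WithTop.coe_ne_top
      · rwa [WithTop.coe_inj.1 h]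
    have h₇' : ∀ i (j : Fin n), (i, (j : WithTop (Fin n))) ∈ F → i ≤ j := fun i j hij =>
      h₇ i (List.mem_finRange i) j (List.mem_finRange j) (h₁ i _ hij) (h₂' i j hij) hij
    refine ⟨h₁, fun i j hij => ⟨h₂' i j hij, h₇' i j hij⟩, h₃, fun j hj => h₄ j ⟨j, rfl, hj⟩, h₅,
      fun i i' j => h₆ i i' j WithTop.coe_ne_top, h₈, fun S hS hc => ?_⟩
    rcases S.eq_empty_or_nonempty with rfl | hne
    · simp
    obtain ⟨p, hp, hmax⟩ := S.exists_max_image Prod.fst hne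
    have hpb : (p.1 : WithTop (Fin n)) ≤ p.2 := by
      obtain ⟨i, b⟩ := p
      induction b using WithTop.recTopCoe with
      | top => exact le_top
      | coe j => exact WithTop.coe_le_coe.2 (h₇' i j (hS _ hp).1)
    refine nestingBound_of_checks hl h₉ (List.mem_finRange p.1) (h₁ _ _ (hS p hp).1) S
      (fun q hq => ⟨(hS q hq).1, ⟨?_, hmax q hq⟩, ?_, ?_⟩) hc
    · rw [mem_lefts_kindWord]
      exact ⟨List.mem_finRange _, h₁ _ _ (hS q hq).1⟩
    · simp only [mem_rights_kindWord, List.mem_finRange, true_and]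
      exact h₂ _ _ (hS q hq).1
    · by_cases hqp : q = p
      · exact hqp ▸ hpb
      · rcases hc q hq p hp hqp with h | h
        · exact hpb.trans h.2.le
        · exact absurd h.1 (hmax q hq).not_gt
  · rintro ⟨h₁, h₂, h₃, h₄, h₅, h₆, h₇, h₈⟩
    refine ⟨?_, ?_, ?_, ?_, h₅, ?_, ?_, h₇, checks_of_nestingBound fun c hc => ?_⟩
    · intro i b hb
      rw [mem_lefts_kindWord]
      exact ⟨List.mem_finRange i, h₁ i b hb⟩
    · intro i b hb
      induction b using WithTop.recTopCoe with
      | top => exact Or.inl rfl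
      | coe j =>
        exact Or.inr ((mem_rights_kindWord _ _).2 ⟨j, rfl, List.mem_finRange j, (h₂ i j hb).1⟩)
    · intro i hi
      exact h₃ i ((mem_lefts_kindWord _ _).1 hi).2
    · intro b hb
      obtain ⟨j, rfl, -, hj⟩ := (mem_rights_kindWord _ _).1 hb
      exact h₄ j hj
    · intro i i' b hb
      lift b to Fin n using hb
      exact h₆ i i' b
    · exact (leftFirst_kindWord _ _ hl).2 fun i _ j _ _ _ hij => (h₂ i j hij).2
    · exact check_mem_kindWord _ _ hc ▸ h₈

end Fin

theorem nestingBound_iff_not_exists {I J : Type} [LinearOrder I] [LinearOrder J]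
    {F : Set (I × J)} {l : ℕ} :
    NestingBound F Set.univ Set.univ l ↔
      ¬ ∃ (a : Fin (l + 1) → I) (b : Fin (l + 1) → J), StrictMono a ∧ StrictAnti b ∧
        ∀ r, (a r, b r) ∈ F := by
  classical
  constructor
  · rintro h ⟨a, b, ha, hb, hF⟩
    have := h (Finset.univ.image fun r => (a r, b r)) ?_ ?_
    · rw [Finset.card_image_of_injective _ fun r r' h => ha.injective (Prod.mk.inj h).1] at this
      simp at this
    · simpa using hF
    · simp only [Finset.mem_image, Finset.mem_univ, true_and]
      rintro _ ⟨r, rfl⟩ _ ⟨r', rfl⟩ hne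
      rcases lt_trichotomy r r' with h | rfl | h
      · exact Or.inl ⟨ha h, hb h⟩
      · exact absurd rfl hne
      · exact Or.inr ⟨ha h, hb h⟩
  · intro h S hS hc
    by_contra! hcard
    obtain ⟨S', hS', hcard'⟩ := Finset.exists_subset_card_eq (s := S) (n := l + 1) (by omega)
    have hinj : Set.InjOn Prod.fst (S' : Set (I × J)) := by
      intro p hp q hq hpq
      by_contra hne
      rcases hc p (hS' hp) q (hS' hq) hne with h | h <;> simp [hpq] at h
    have hA := (Finset.card_image_of_injOn hinj).trans hcard'
    have hex : ∀ r, ∃ b, ((S'.image Prod.fst).orderEmbOfFin hA r, b) ∈ S' := by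
      intro r
      obtain ⟨⟨a, b⟩, hp, hpr⟩ := Finset.mem_image.1 (Finset.orderEmbOfFin_mem _ hA r)
      exact ⟨b, hpr ▸ hp⟩
    choose b hb using hex
    refine h ⟨_, b, OrderEmbedding.strictMono _, fun r r' hr => ?_, fun r => (hS _ (hS' (hb r))).1⟩
    have hlt := (OrderEmbedding.strictMono ((S'.image Prod.fst).orderEmbOfFin hA)) hr
    rcases hc _ (hS' (hb r)) _ (hS' (hb r')) (fun h => hlt.ne (Prod.mk.inj h).1) with h | h
    · exact h.2
    · exact absurd h.1 hlt.not_gt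

namespace OpenPartitionDiagram

variable {n : ℕ} (D : OpenPartitionDiagram n)

/-- The enhanced arcs of a diagram, together with its open arcs as pairs with second entry `⊤`. -/
def filling : Set (Fin n × WithTop (Fin n)) :=
  {p | (p.2 = ⊤ ∧ p.1 ∈ D.openArcs) ∨ ∃ j : Fin n, p.2 = j ∧ D.EnhancedArc p.1 j}

variable {D}

@[simp] theorem mem_filling_top {i : Fin n} : (i, ⊤) ∈ D.filling ↔ i ∈ D.openArcs := by
  simp [filling]

@[simp] theorem mem_filling_coe {i j : Fin n} :
    (i, (j : WithTop (Fin n))) ∈ D.filling ↔ D.EnhancedArc i j := by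
  simp [filling]

theorem EnhancedArc.le {i j : Fin n} (h : D.EnhancedArc i j) : i ≤ j := by
  rcases h with h | ⟨rfl, -⟩
  · exact (D.lt_of_mem i j h).le
  · exact le_rfl

theorem nestingBound_filling_iff {k : ℕ} :
    NestingBound D.filling Set.univ Set.univ k ↔
      ¬ D.HasEnhancedNesting (k + 1) ∧ ¬ D.HasFutureEnhancedNestingSucc k := by
  rw [nestingBound_iff_not_exists, ← not_or, not_iff_not]
  constructor
  · rintro ⟨a, b, ha, hb, hF⟩
    by_cases h₀ : b 0 = ⊤
    · right
      have hne : ∀ r : Fin k, b r.succ ≠ ⊤ := fun r => (h₀ ▸ hb (Fin.succ_pos r)).ne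
      choose b' hb' using fun r => WithTop.ne_top_iff_exists.1 (hne r)
      have hF' : ∀ r : Fin k, D.EnhancedArc (a r.succ) (b' r) := fun r => by
        rw [← mem_filling_coe, hb']
        exact hF _
      refine ⟨a 0, ?_, fun r => a r.succ, b', ⟨fun r r' h => ha (Fin.succ_lt_succ_iff.2 h),
        fun r r' h => ?_, fun r => ⟨(hF' r).le, hF' r⟩⟩, fun r => ha (Fin.succ_pos r)⟩
      · rw [← mem_filling_top, ← h₀]
        exact hF 0
      · rw [← WithTop.coe_lt_coe, hb', hb']
        exact hb (Fin.succ_lt_succ_iff.2 h)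
    · left
      have hne : ∀ r, b r ≠ ⊤ := fun r =>
        ((hb.antitone (Fin.zero_le r)).trans_lt (lt_top_iff_ne_top.2 h₀)).ne
      choose b' hb' using fun r => WithTop.ne_top_iff_exists.1 (hne r)
      have hF' : ∀ r, D.EnhancedArc (a r) (b' r) := fun r => by
        rw [← mem_filling_coe, hb']
        exact hF _
      refine ⟨a, b', ha, fun r r' h => ?_, fun r => ⟨(hF' r).le, hF' r⟩⟩
      rw [← WithTop.coe_lt_coe, hb', hb']
      exact hb h
  · rintro (⟨a, b, ha, hb, h⟩ | ⟨o, ho, a, b, ⟨ha, hb, h⟩, hoa⟩)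
    · exact ⟨a, fun r => b r, ha, fun r r' hr => WithTop.coe_lt_coe.2 (hb hr),
        fun r => mem_filling_coe.2 (h r).2⟩
    · refine ⟨Fin.cons o a, Fin.cons ⊤ fun r => (b r : WithTop (Fin n)), ?_, ?_, ?_⟩
      · intro r
        refine Fin.cases ?_ (fun r => ?_) r <;> intro r' <;>
          refine Fin.cases ?_ (fun r' => ?_) r' <;> intro hr
        · exact absurd hr (lt_irrefl _)
        · exact hoa r'
        · exact absurd hr (Fin.not_lt_zero _)
        · exact ha (Fin.succ_lt_succ_iff.1 hr)
      · intro r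
        refine Fin.cases ?_ (fun r => ?_) r <;> intro r' <;>
          refine Fin.cases ?_ (fun r' => ?_) r' <;> intro hr
        · exact absurd hr (lt_irrefl _)
        · exact WithTop.coe_lt_top _
        · exact absurd hr (Fin.not_lt_zero _)
        · exact WithTop.coe_lt_coe.2 (hb (Fin.succ_lt_succ_iff.1 hr))
      · intro r
        refine Fin.cases ?_ (fun r => ?_) r
        · exact mem_filling_top.2 ho
        · exact mem_filling_coe.2 (h r).2

end OpenPartitionDiagram

end Hesitating

namespace Hesitating

section kindOf

variable {n m k : ℕ} {F : Set (Fin n × WithTop (Fin n))} {t : Fin n → Kind}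

open Classical in
/-- The kinds of the vertices in a filling. -/
noncomputable def kindOf (F : Set (Fin n × WithTop (Fin n))) (i : Fin n) : Kind :=
  if ∃ b, (i, b) ∈ F then
    if ∃ a, (a, (i : WithTop (Fin n))) ∈ F then .both else .opener
  else .closer

theorem Filling.kindOf_eq (h : Filling (kindWord k t (List.finRange n)) m F) : kindOf F = t := by
  obtain ⟨h₁, h₂, h₃, h₄, -⟩ := filling_kindWord_iff.1 h
  funext i
  have h₅ : (∃ b, (i, b) ∈ F) ↔ t i ≠ .closer := ⟨fun ⟨b, hb⟩ => h₁ i b hb, h₃ i⟩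
  have h₆ : (∃ a, (a, (i : WithTop (Fin n))) ∈ F) ↔ t i ≠ .opener :=
    ⟨fun ⟨a, ha⟩ => (h₂ a i ha).1, h₄ i⟩
  cases ht : t i <;> simp [kindOf, h₅, h₆, ht]

theorem kindOf_ne_closer {i : Fin n} : kindOf F i ≠ .closer ↔ ∃ b, (i, b) ∈ F := by
  unfold kindOf
  split_ifs with h₁ h₂ <;> simp [h₁]

theorem kindOf_ne_opener {i : Fin n} :
    kindOf F i ≠ .opener ↔ (∃ a, (a, (i : WithTop (Fin n))) ∈ F) ∨ ∀ b, (i, b) ∉ F := by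
  unfold kindOf
  split_ifs with h₁ h₂
  · simp [h₂]
  · obtain ⟨b, hb⟩ := h₁
    simp only [ne_eq, not_true_eq_false, h₂, false_or, false_iff, not_forall, not_not]
    exact ⟨b, hb⟩
  · simpa using Or.inr (not_exists.1 h₁)

end kindOf

namespace OpenPartitionDiagram

variable {n : ℕ} {D : OpenPartitionDiagram n}

theorem exists_mem_filling (D : OpenPartitionDiagram n) (i : Fin n) :
    (∃ a, (a, (i : WithTop (Fin n))) ∈ D.filling) ∨ ∃ b, (i, b) ∈ D.filling := by
  by_cases h : D.IsIsolated i
  · exact Or.inl ⟨i, mem_filling_coe.2 (Or.inr ⟨rfl, h⟩)⟩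
  · simp only [IsIsolated, not_and_or, not_forall, not_not] at h
    rcases h with h | ⟨u, h | h⟩
    · exact Or.inr ⟨⊤, mem_filling_top.2 h⟩
    · exact Or.inr ⟨u, mem_filling_coe.2 (Or.inl h)⟩
    · exact Or.inl ⟨u, mem_filling_coe.2 (Or.inl h)⟩

theorem filling_left_unique {i : Fin n} {b b' : WithTop (Fin n)} (h : (i, b) ∈ D.filling)
    (h' : (i, b') ∈ D.filling) : b = b' := by
  induction b using WithTop.recTopCoe with
  | top =>
    induction b' using WithTop.recTopCoe with
    | top => rfl
    | coe j =>
      rw [mem_filling_top] at h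
      rcases mem_filling_coe.1 h' with h' | ⟨-, h'⟩
      · exact absurd h (D.not_mem_openArcs _ _ h')
      · exact absurd h h'.1
  | coe j =>
    rw [mem_filling_coe] at h
    induction b' using WithTop.recTopCoe with
    | top =>
      rw [mem_filling_top] at h'
      rcases h with h | ⟨-, h⟩
      · exact absurd h' (D.not_mem_openArcs _ _ h)
      · exact absurd h' h.1
    | coe j' =>
      rw [mem_filling_coe] at h'
      rcases h with h | ⟨rfl, h⟩ <;> rcases h' with h' | ⟨rfl, h'⟩
      · rw [D.left_unique _ _ _ h h']
      · exact absurd h (h'.2 _).1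
      · exact absurd h' (h.2 _).1
      · rfl

theorem enhancedArc_right_unique {i i' j : Fin n} (h : D.EnhancedArc i j)
    (h' : D.EnhancedArc i' j) : i = i' := by
  rcases h with h | ⟨rfl, h⟩ <;> rcases h' with h' | ⟨rfl, h'⟩
  · exact D.right_unique _ _ _ h h'
  · exact absurd h (h'.2 _).2
  · exact absurd h' (h.2 _).2
  · rfl

theorem filling_filling {k m : ℕ} (hD : D ∈ openDiagrams k n m) :
    Filling (kindWord k (kindOf D.filling) (List.finRange n)) m D.filling := by
  refine filling_kindWord_iff.2 ⟨fun i b hb => kindOf_ne_closer.2 ⟨b, hb⟩,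
    fun i j hij => ⟨kindOf_ne_opener.2 (Or.inl ⟨i, hij⟩), (mem_filling_coe.1 hij).le⟩,
    fun i hi => kindOf_ne_closer.1 hi, fun j hj => ?_, fun i b b' => filling_left_unique,
    fun i i' j h h' => enhancedArc_right_unique (mem_filling_coe.1 h) (mem_filling_coe.1 h'), ?_,
    nestingBound_filling_iff.2 hD.2⟩
  · refine (kindOf_ne_opener.1 hj).elim id fun h => ?_
    exact (D.exists_mem_filling j).resolve_right fun ⟨b, hb⟩ => h b hb
  · simp only [mem_filling_top]
    exact (Set.ncard_coe_finset D.openArcs).trans hD.1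

theorem filling_injective :
    Function.Injective (filling : OpenPartitionDiagram n → Set (Fin n × WithTop (Fin n))) := by
  have key {D D' : OpenPartitionDiagram n} (h : D.filling = D'.filling) {p : Fin n × Fin n}
      (hp : p ∈ D.arcs) : p ∈ D'.arcs := by
    have : D'.EnhancedArc p.1 p.2 := by
      rw [← mem_filling_coe, ← h, mem_filling_coe]
      exact Or.inl hp
    exact this.resolve_right fun h => (D.lt_of_mem p.1 p.2 hp).ne h.1
  intro D D' h
  ext p
  · exact ⟨key h, key h.symm⟩
  · rw [← mem_filling_top, h, mem_filling_top]

theorem exists_filling_eq {k m : ℕ} {t : Fin n → Kind} {F : Set (Fin n × WithTop (Fin n))}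
    (hF : Filling (kindWord k t (List.finRange n)) m F) :
    ∃ D ∈ openDiagrams k n m, D.filling = F := by
  classical
  obtain ⟨h₁, h₂, h₃, h₄, h₅, h₆, h₇, h₈⟩ := filling_kindWord_iff.1 hF
  let D : OpenPartitionDiagram n :=
    { arcs := {p | (p.1, (p.2 : WithTop (Fin n))) ∈ F ∧ p.1 ≠ p.2}
      openArcs := {i | (i, (⊤ : WithTop (Fin n))) ∈ F}
      lt_of_mem := fun i j h => by
        have h := (Finset.mem_filter.1 h).2
        exact lt_of_le_of_ne (h₂ i j h.1).2 h.2
      left_unique := fun i j j' h h' => WithTop.coe_inj.1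
        (h₅ i j j' (Finset.mem_filter.1 h).2.1 (Finset.mem_filter.1 h').2.1)
      right_unique := fun i i' j h h' =>
        h₆ i i' j (Finset.mem_filter.1 h).2.1 (Finset.mem_filter.1 h').2.1
      not_mem_openArcs := fun i j h h' => WithTop.coe_ne_top
        (h₅ i j ⊤ (Finset.mem_filter.1 h).2.1 (Finset.mem_filter.1 h').2) }
  have harcs : ∀ i j, (i, j) ∈ D.arcs ↔ (i, (j : WithTop (Fin n))) ∈ F ∧ i ≠ j := by simp [D]
  have hopen : ∀ i, i ∈ D.openArcs ↔ (i, ⊤) ∈ F := by simp [D]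
  have hiso : ∀ i, D.IsIsolated i ↔ (i, (i : WithTop (Fin n))) ∈ F := by
    intro i
    simp only [IsIsolated, harcs, hopen, not_and, not_not]
    constructor
    · rintro ⟨h, h'⟩
      by_cases hi : t i = .closer
      · obtain ⟨a, ha⟩ := h₄ i (by simp [hi])
        have := (h' a).2 ha
        rwa [this] at ha
      · obtain ⟨b, hb⟩ := h₃ i hi
        induction b using WithTop.recTopCoe with
        | top => exact absurd hb h
        | coe j =>
          have := (h' j).1 hb
          rwa [← this] at hb
    · intro h
      refine ⟨fun h' => WithTop.coe_ne_top (h₅ _ _ _ h h'), fun u => ⟨fun hu => ?_, fun hu => ?_⟩⟩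
      · exact WithTop.coe_inj.1 (h₅ _ _ _ h hu)
      · exact h₆ _ _ _ hu h
  have hD : D.filling = F := by
    ext ⟨i, b⟩
    induction b using WithTop.recTopCoe with
    | top => rw [mem_filling_top, hopen]
    | coe j =>
      rw [mem_filling_coe, EnhancedArc, harcs, hiso]
      constructor
      · rintro (h | ⟨rfl, h⟩)
        exacts [h.1, h]
      · intro h
        by_cases hij : i = j
        · subst hij
          exact Or.inr ⟨rfl, h⟩
        · exact Or.inl ⟨h, hij⟩
  refine ⟨D, ⟨?_, nestingBound_filling_iff.1 (hD ▸ h₈)⟩, hD⟩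
  rw [← h₇, ← Set.ncard_coe_finset]
  congr 1
  ext i
  exact hopen i

end OpenPartitionDiagram

theorem openDiagrams_equiv_sigma_filling (k n m : ℕ) :
    Nonempty (openDiagrams k n m ≃ Σ t : Fin n → Kind,
      {F // Filling (kindWord k t (List.finRange n)) m F}) := by
  refine ⟨Equiv.ofBijective (fun D => ⟨kindOf D.1.filling, D.1.filling,
    OpenPartitionDiagram.filling_filling D.2⟩) ⟨fun D D' h => ?_, ?_⟩⟩
  · refine Subtype.ext (OpenPartitionDiagram.filling_injective ?_)
    exact congrArg (fun p : Σ t : Fin n → Kind,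
      {F // Filling (kindWord k t (List.finRange n)) m F} => p.2.1) h
  · rintro ⟨t, F, hF⟩
    obtain ⟨D, hD, rfl⟩ := OpenPartitionDiagram.exists_filling_eq hF
    exact ⟨⟨D, hD⟩, Sigma.subtype_ext hF.kindOf_eq rfl⟩

theorem tableaux_equiv_openDiagrams (k n m : ℕ) :
    Nonempty (tableaux k n m ≃ openDiagrams k n m) := by
  refine ⟨(tableaux_equiv_sigma_path k n m).some.trans <| (Equiv.sigmaCongrRight fun t => ?_).trans
    (openDiagrams_equiv_sigma_filling k n m).some.symm⟩
  rw [← map_toMove_kindWord]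
  exact (path_equiv_filling growthRule_addBox m
    (sortedWord_kindWord k t (List.pairwise_lt_finRange n))).some

end Hesitating

namespace Hesitating

/-! ### Tableaux as lattice walks -/

theorem youngDiagram_ext_rowLen {μ ν : YoungDiagram} (h : ∀ i, μ.rowLen i = ν.rowLen i) :
    μ = ν := by
  ext ⟨i, j⟩
  rw [YoungDiagram.mem_cells, YoungDiagram.mem_cells, YoungDiagram.mem_iff_lt_rowLen,
    YoungDiagram.mem_iff_lt_rowLen, h]

theorem rowLen_eq_iff {μ : YoungDiagram} {i n : ℕ} :
    μ.rowLen i = n ↔ ∀ j, (i, j) ∈ μ ↔ j < n := by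
  simp only [YoungDiagram.mem_iff_lt_rowLen]
  exact ⟨fun h i => h ▸ Iff.rfl, fun h => eq_of_forall_lt_iff h⟩

theorem addBox_iff_rowLen {μ ν : YoungDiagram} :
    AddBox μ ν ↔ ∃ i, ∀ r, ν.rowLen r = μ.rowLen r + if r = i then 1 else 0 := by
  constructor
  · rintro ⟨⟨i, j⟩, hc, hν⟩
    have hmem : ∀ a b, (a, b) ∈ ν ↔ (a = i ∧ b = j) ∨ b < μ.rowLen a := fun a b => by
      rw [← YoungDiagram.mem_cells, hν, Finset.mem_insert, YoungDiagram.mem_cells, Prod.mk.injEq,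
        YoungDiagram.mem_iff_lt_rowLen]
    rw [YoungDiagram.mem_cells, YoungDiagram.mem_iff_lt_rowLen] at hc
    have hj : j = μ.rowLen i := by
      by_contra hne
      have := ν.up_left_mem (j1 := μ.rowLen i) le_rfl (by omega : _ ≤ j)
        ((hmem i j).2 (Or.inl ⟨rfl, rfl⟩))
      rw [hmem] at this
      omega
    refine ⟨i, fun r => rowLen_eq_iff.2 fun b => ?_⟩
    rw [hmem]
    split_ifs with hr
    · subst hr
      omega
    · omega
  · rintro ⟨i, h⟩
    refine ⟨(i, μ.rowLen i), by simp [YoungDiagram.mem_iff_lt_rowLen], ?_⟩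
    ext ⟨a, b⟩
    rw [Finset.mem_insert, YoungDiagram.mem_cells, YoungDiagram.mem_cells, Prod.mk.injEq,
      YoungDiagram.mem_iff_lt_rowLen, YoungDiagram.mem_iff_lt_rowLen, h]
    split_ifs with hr
    · subst hr
      omega
    · omega

/-- The point `λ + δ` of the chamber that corresponds to a Ferrers diagram `λ`. -/
def toPoint (k : ℕ) (μ : YoungDiagram) : Fin k → ℤ := fun i => μ.rowLen i + delta k i

section toPoint

variable {k : ℕ} {μ ν : YoungDiagram}

theorem toPoint_mem_chamber (k : ℕ) (μ : YoungDiagram) : toPoint k μ ∈ chamber k := by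
  refine ⟨fun i j hij => ?_, fun i => ?_⟩
  · have := μ.rowLen_anti i j hij.le
    have : (i : ℕ) < j := hij
    simp only [toPoint, delta]
    omega
  · simp only [toPoint, delta]
    omega

theorem rowLen_eq_zero (h : μ.colLen 0 ≤ k) {i : ℕ} (hi : k ≤ i) : μ.rowLen i = 0 := by
  rw [rowLen_eq_iff]
  refine fun j => iff_of_false (fun hj => ?_) (Nat.not_lt_zero j)
  have := YoungDiagram.mem_iff_lt_colLen.1 (μ.up_left_mem le_rfl (Nat.zero_le j) hj)
  omega

theorem toPoint_injOn (hμ : μ.colLen 0 ≤ k) (hν : ν.colLen 0 ≤ k) (h : toPoint k μ = toPoint k ν) :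
    μ = ν := by
  refine youngDiagram_ext_rowLen fun i => ?_
  by_cases hi : i < k
  · simpa [toPoint] using congrFun h ⟨i, hi⟩
  · rw [rowLen_eq_zero hμ (not_lt.1 hi), rowLen_eq_zero hν (not_lt.1 hi)]

theorem chamber_sub_delta_antitone {x : Fin k → ℤ} (hx : x ∈ chamber k) :
    Antitone (fun i => x i - delta k i) := by
  have key : ∀ (d : ℕ) (i j : Fin k), (j : ℕ) = i + d → x j + d ≤ x i := by
    intro d
    induction d with
    | zero =>
      intro i j h
      obtain rfl : j = i := Fin.ext h
      simp
    | succ d ih =>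
      intro i j h
      have h₁ := ih i ⟨i + d, by omega⟩ rfl
      have h₂ : x j < x ⟨i + d, by omega⟩ := hx.1 (Fin.lt_def.2 (by simp only; omega))
      push_cast
      omega
  intro i j hij
  have h : (i : ℕ) ≤ j := hij
  have := key (j - i) i j (by omega)
  simp only [delta]
  omega

theorem exists_toPoint_eq {x : Fin k → ℤ} (hx : x ∈ chamber k) :
    ∃ μ : YoungDiagram, μ.colLen 0 ≤ k ∧ toPoint k μ = x := by
  have hanti := chamber_sub_delta_antitone hx
  have hpos : ∀ i, 0 ≤ x i - delta k i := by
    intro i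
    have hk : k - 1 < k := Nat.sub_one_lt_of_lt i.2
    have h₁ := hanti (show i ≤ ⟨k - 1, hk⟩ from Fin.le_def.2 (by simp only; omega))
    have h₂ := hx.2 ⟨k - 1, hk⟩
    simp only [delta] at h₁ ⊢
    omega
  have hs : (List.ofFn fun i => (x i - delta k i).toNat).SortedGE :=
    List.sortedGE_ofFn_iff.2 fun i j hij => Int.toNat_le_toNat (hanti hij)
  have hmem : ∀ a b, (a, b) ∈ YoungDiagram.ofRowLens _ hs ↔
      ∃ h : a < k, (b : ℤ) < x ⟨a, h⟩ - delta k ⟨a, h⟩ := by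
    intro a b
    rw [YoungDiagram.mem_ofRowLens]
    simp
  refine ⟨YoungDiagram.ofRowLens _ hs, ?_, funext fun i => ?_⟩
  · by_contra! h
    rw [← YoungDiagram.mem_iff_lt_colLen, hmem] at h
    obtain ⟨h, -⟩ := h
    exact lt_irrefl _ h
  · have : (YoungDiagram.ofRowLens _ hs).rowLen i = (x i - delta k i).toNat := by
      rw [rowLen_eq_iff]
      intro j
      rw [hmem]
      simp
    rw [toPoint, this, Int.toNat_of_nonneg (hpos i)]
    ring

theorem unitStep_toPoint_iff (hμ : μ.colLen 0 ≤ k) (hν : ν.colLen 0 ≤ k) :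
    UnitStep (toPoint k μ) (toPoint k ν) ↔ AddBox μ ν := by
  rw [addBox_iff_rowLen]
  constructor
  · rintro ⟨i, h⟩
    refine ⟨i, fun r => ?_⟩
    by_cases hr : r < k
    · have := congrFun h ⟨r, hr⟩
      simp only [toPoint, Pi.add_apply, Pi.single_apply, Fin.ext_iff] at this
      split_ifs at this ⊢ <;> omega
    · rw [rowLen_eq_zero hμ (not_lt.1 hr), rowLen_eq_zero hν (not_lt.1 hr), if_neg (by omega)]
  · rintro ⟨i, h⟩
    have hi : i < k := by
      by_contra hi
      have := h i
      rw [rowLen_eq_zero hμ (not_lt.1 hi), rowLen_eq_zero hν (not_lt.1 hi)] at this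
      simp at this
    refine ⟨⟨i, hi⟩, funext fun r => ?_⟩
    have := h r
    simp only [toPoint, Pi.add_apply, Pi.single_apply, Fin.ext_iff]
    split_ifs at this ⊢ <;> omega

theorem toPoint_bot : toPoint k ⊥ = delta k := by
  funext i
  have : (⊥ : YoungDiagram).rowLen i = 0 := rowLen_eq_iff.2 (by simp)
  simp [toPoint, this]

theorem rowLen_rowDiagram (m i : ℕ) : (rowDiagram m).rowLen i = if i = 0 then m else 0 := by
  rw [rowLen_eq_iff]
  intro j
  rw [mem_rowDiagram]
  split_ifs <;> omega

theorem isEndpoint_toPoint_iff {m : ℕ} (hμ : μ.colLen 0 ≤ k) :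
    IsEndpoint k m (toPoint k μ) ↔ μ = rowDiagram m := by
  constructor
  · rintro (⟨rfl, h⟩ | ⟨hk, h⟩)
    · rw [← toPoint_bot, ← rowDiagram_zero] at h
      refine toPoint_injOn hμ ?_ h
      have := growthRule_addBox.stat_zero
      simp only [firstCol] at this
      omega
    · refine youngDiagram_ext_rowLen fun i => ?_
      rw [rowLen_rowDiagram]
      by_cases hi : i < k
      · have := congrFun h ⟨i, hi⟩
        simp only [toPoint, Pi.add_apply, Pi.single_apply, Fin.ext_iff] at this
        split_ifs at this ⊢ <;> omega
      · rw [rowLen_eq_zero hμ (not_lt.1 hi), if_neg (by omega)]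
  · rintro rfl
    rcases Nat.eq_zero_or_pos k with rfl | hk
    · refine Or.inl ⟨?_, funext fun i => i.elim0⟩
      have := rowLen_eq_zero hμ (le_refl 0)
      simpa [rowLen_rowDiagram] using this
    · refine Or.inr ⟨hk, funext fun i => ?_⟩
      simp only [toPoint, rowLen_rowDiagram, Pi.add_apply, Pi.single_apply, Fin.ext_iff]
      split_ifs <;> simp [add_comm]

end toPoint

theorem isHesitating_toPoint_iff {k n : ℕ} {f : Fin (2 * n + 1) → YoungDiagram}
    (hf : ∀ i, (f i).colLen 0 ≤ k) :
    IsHesitating UnitStep (fun i => toPoint k (f i)) ↔ IsHesitating AddBox f := by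
  have h : ∀ i j, toPoint k (f i) = toPoint k (f j) ↔ f i = f j := fun i j =>
    ⟨toPoint_injOn (hf i) (hf j), congrArg _⟩
  simp only [IsHesitating, unitStep_toPoint_iff (hf _) (hf _), h]

theorem mem_walks_iff {k n m : ℕ} {f : Fin (2 * n + 1) → YoungDiagram}
    (hf : ∀ i, (f i).colLen 0 ≤ k) :
    (fun i => toPoint k (f i)) ∈ walks k n m ↔ f ∈ tableaux k n m := by
  have h₀ : toPoint k (f 0) = delta k ↔ f 0 = ⊥ := by
    constructor
    · intro h
      rw [← rowDiagram_zero]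
      exact (isEndpoint_toPoint_iff (hf 0)).1 (Or.inl ⟨rfl, h⟩)
    · intro h
      rw [h, toPoint_bot]
  have h₁ : f (Fin.last _) = rowDiagram m ↔
      (f (Fin.last (2 * n))).cells = {0} ×ˢ Finset.range m := YoungDiagram.ext_iff
  simp only [walks, tableaux, Set.mem_ofPred_eq, isHesitating_toPoint_iff hf, toPoint_mem_chamber,
    implies_true, true_and, h₀, isEndpoint_toPoint_iff (hf _), h₁, hf]

theorem tableaux_equiv_walks (k n m : ℕ) : Nonempty (tableaux k n m ≃ walks k n m) := by
  refine ⟨Equiv.ofBijective (fun f => ⟨fun i => toPoint k (f.1 i), (mem_walks_iff f.2.2.2.1).2 f.2⟩)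
    ⟨fun f f' h => ?_, ?_⟩⟩
  · exact Subtype.ext <| funext fun i => toPoint_injOn (f.2.2.2.1 i) (f'.2.2.2.1 i)
      (congrFun (congrArg Subtype.val h) i)
  · rintro ⟨w, hw⟩
    choose f hf hfw using fun i => exists_toPoint_eq (hw.2.1 i)
    obtain rfl : (fun i => toPoint k (f i)) = w := funext hfw
    exact ⟨⟨f, (mem_walks_iff hf).1 hw⟩, rfl⟩

end Hesitating

theorem theorem1 (k n m : ℕ) :
    Nonempty (Hesitating.tableaux k n m ≃ Hesitating.walks k n m) ∧
      Nonempty (Hesitating.tableaux k n m ≃ Hesitating.openDiagrams k n m) ∧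
      Nonempty (Hesitating.walks k n m ≃ Hesitating.openDiagrams k n m) := by
  obtain ⟨e₁⟩ := Hesitating.tableaux_equiv_walks k n m
  obtain ⟨e₂⟩ := Hesitating.tableaux_equiv_openDiagrams k n m
  exact ⟨⟨e₁⟩, ⟨e₂⟩, ⟨e₁.symm.trans e₂⟩⟩
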